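/- **Parallel token swapping.** Let $G=(V,E)$ be a finite graph. A configuration is a bijection $C:V\to V$, where $C(v)$ is the token lying on the vertex $v$. A matching $M\subseteq E$ transforms $C$ into the configuration $MC$ with $MC(v)=C(w)$ if $\{v,w\}\in M$, and $MC(v)=C(v)$ if no edge of $M$ contains $v$. A solution for $(G,C)$ is a sequence of matchings $(M_1,\dots,M_k)$ with $M_k\cdots M_1C=\mathrm{Id}$; its size is $k$, and $OPT$ is the minimum size of a solution. **The algorithm on a cycle.** Let $n\ge 3$ and let $G$ be the $n$-cycle with vertices $1,\dots,n$ and edges $e_i=\{i,i+1\}$ for $1\le i\le n$, where $n+1$ means $1$. Put $r=\lfloor n/2\rfloor$. The edge opposite to $e_i$ is $e_{i+r}$ if $i\le r$ and $e_{i-r}$ if $i>r$. The edge $e_i$ is *reasonable* with respect to a configuration $C$ if, on the path obtained from $G$ by deleting the edge opposite to $e_i$, the tokens on $i$ and $i+1$ occur in the order opposite to the order of their destinations $C(i)$ and $C(i+1)$. Let $E_1=\{e_i: i \text{ odd},\ i<n\}$ and $E_2=\{e_i : i\text{ even}\}$, and for odd $n$ let $E_3=\{e_n\}$. * *Cycle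 odd-even algorithm.* In each round, swap along all edges of the current set that are reasonable with respect to the current configuration. The sets are used in the cyclic order $E_1,E_2$ if $n$ is even, and $E_1,E_3,E_2,E_3$ if $n$ is odd. Stop as soon as the configuration is $\mathrm{Id}$ and output the matchings used. Output ERROR if the configuration is not $\mathrm{Id}$ after $n$ rounds, or as soon as a number of consecutive rounds equal to the period of the schedule ($2$ for even $n$, $4$ for odd $n$) have made no swap. * *Path odd-even sorting.* On the path $1,2,\dots,n$ (the cycle without the edge $e_n$), for $k=1,2,\dots$ swap in round $k$ along all edges $e_i$ with $i<n$, $i\equiv k \pmod 2$ and $C(i)>C(i+1)$, where $C$ is the current configuration, until the configuration is $\mathrm{Id}$. Output the matchings used. The algorithm $\mathcal A$ outputs the result of the path odd-even sorting if the cycle odd-even algorithm returns ERROR or if its sequence is longer than that of the path odd-even sorting; otherwise $\mathcal A$ outputs the result of the cycle odd-even algorithm. **Theorem.** The algorithm $\mathcal A$ runs in polynomial time: one program of a random access machine (with addition, truncated subtraction and comparisons as its unit-cost operations) computes the output of $\mathcal A$ from $n$ and $C$, for all $n\ge 3$ and all configurations $C$ on the $n$-cycle, in a number of steps bounded by a polynomial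 in $n$. For every $n\ge 3$ and every configuration $C$ on the $n$-cycle, the output of $\mathcal A$ is a solution, and * (a) if $n$ is even, its size is at most $2\,OPT$; * (b) if $n$ is odd, its size is at most $2\,OPT+1$. -/

import Mathlib

namespace PTS

/-! ### Parallel token swapping on a graph

The token set is a copy of the vertex set, so a configuration is a (bijective) map `C : V → V`,
`C v` being the token that lies on the vertex `v`; the target configuration is `id`. -/

section Graph

variable {V : Type*}

/-- `M` is a matching of `G`: a set of edges of `G`, no two of which share a vertex. -/
def IsMatching (G : SimpleGraph V) (M : Finset (Sym2 V)) : Prop :=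
  (∀ e ∈ M, e ∈ G.edgeSet) ∧ ∀ e ∈ M, ∀ f ∈ M, ∀ v, v ∈ e → v ∈ f → e = f

open Classical in
/-- The configuration `M C` that is obtained from `C` by swapping along all edges of `M`:
`M C (v) = C w` if `{v, w} ∈ M`, and `M C (v) = C v` if no edge of `M` contains `v`. -/
noncomputable def route (M : Finset (Sym2 V)) (C : V → V) (v : V) : V :=
  if h : ∃ w, s(v, w) ∈ M then C h.choose else C v

/-- `M_k ⋯ M_1 C` for a sequence `(M_1, …, M_k)`. -/
noncomputable def routeSeq (L : List (Finset (Sym2 V))) (C : V → V) : V → V :=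
  L.foldl (fun D M => route M D) C

/-- A solution: a sequence of matchings that routes `C` to the identity configuration. -/
def IsSolution (G : SimpleGraph V) (C : V → V) (L : List (Finset (Sym2 V))) : Prop :=
  (∀ M ∈ L, IsMatching G M) ∧ routeSeq L C = id

/-- The minimum size of a solution. -/
noncomputable def opt (G : SimpleGraph V) (C : V → V) : ℕ :=
  sInf {k | ∃ L, IsSolution G C L ∧ L.length = k}

end Graph

/-! ### The algorithms on the cycle `0 - 1 - ⋯ - (n-1) - 0`

The edge `{i, i+1}` has the index `i`, so the closing edge `{n-1, 0}` has the index `n-1`. -/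

section Cycle

variable {n : ℕ}

/-- The next vertex on the cycle. -/
def next (i : Fin n) : Fin n := ⟨(i.val + 1) % n, Nat.mod_lt _ i.pos⟩

/-- The edge with index `i`. -/
def edge (i : Fin n) : Sym2 (Fin n) := s(i, next i)

/-- The index of the edge that is diametrically opposite to the edge `i`.  For odd `n = 2r+1`
the two edges `i + r` and `i + r + 1` are equally far away; this picks `i + r` for `i < r`
and `i + r + 1 - n` for `i ≥ r`. -/
def opposite (n i : ℕ) : ℕ := if i < n / 2 then i + n / 2 else i - n / 2

/-- The position (from `0` to `n-1`) of the vertex `v` on the path `c+1, c+2, …, c` that is left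
of the cycle after the edge `c` is deleted. -/
def pathPos (n c v : ℕ) : ℕ := (v + (n - 1 - c)) % n

/-- The edge `i` is reasonable for `C`: on the path left after deleting the edge opposite to `i`
(where the vertex `i` immediately precedes `next i`) the destination of the token on `next i`
precedes the destination of the token on `i`. -/
def Reasonable (C : Fin n → Fin n) (i : Fin n) : Prop :=
  pathPos n (opposite n i) (C (next i)) < pathPos n (opposite n i) (C i)

instance (C : Fin n → Fin n) (i : Fin n) : Decidable (Reasonable C i) :=
  inferInstanceAs (Decidable (_ < _))

/-- The edges `{0,1}, {2,3}, …`; the edge `{n-1, 0}` is never among them. -/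
def edgesA (n : ℕ) : Finset (Fin n) := {i | i.val % 2 = 0 ∧ i.val + 1 < n}

/-- The edges `{1,2}, {3,4}, …`; for even `n` the edge `{n-1, 0}` is the last of them. -/
def edgesB (n : ℕ) : Finset (Fin n) := {i | i.val % 2 = 1}

/-- The closing edge `{n-1, 0}`. -/
def edgeClosing (n : ℕ) : Finset (Fin n) := {i | i.val + 1 = n}

/-- The edges considered on the cycle after `k` rounds: the schedule `A, B, A, B, …` for even `n`
and `A, closing edge, B, closing edge, A, …` for odd `n`. -/
def cyclePhase (n k : ℕ) : Finset (Fin n) :=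
  if n % 2 = 0 then
    if k % 2 = 0 then edgesA n else edgesB n
  else
    if k % 4 = 0 then edgesA n else if k % 4 = 2 then edgesB n else edgeClosing n

/-- The number of rounds after which the schedule repeats. -/
def period (n : ℕ) : ℕ := if n % 2 = 0 then 2 else 4

/-- The matching used on the cycle after `k` rounds: all reasonable edges of the phase. -/
def cycleRound (k : ℕ) (C : Fin n → Fin n) : Finset (Sym2 (Fin n)) :=
  ((cyclePhase n k).filter (Reasonable C)).image edge

/-- The loop of the cycle odd-even algorithm with at most `fuel` further rounds, after `k` rounds
of which the last `idle` ones made no swap; `none` is the output ERROR.  It gives up when the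
rounds run out, or when a whole period of the schedule has passed without a swap. -/
noncomputable def cycleLoop : ℕ → ℕ → ℕ → (Fin n → Fin n) → Option (List (Finset (Sym2 (Fin n))))
  | 0, _, _, C => if C = id then some [] else none
  | fuel + 1, k, idle, C =>
    if C = id then some []
    else
      let M := cycleRound k C
      let idle' := if M = ∅ then idle + 1 else 0
      if period n ≤ idle' then none
      else (cycleLoop fuel (k + 1) idle' (route M C)).map (M :: ·)

/-- The cycle odd-even algorithm: at most `n` rounds. -/
noncomputable def cycleOddEven (C : Fin n → Fin n) : Option (List (Finset (Sym2 (Fin n)))) :=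
  cycleLoop n 0 0 C

/-- The matching used by odd-even sorting on the path `0 - 1 - ⋯ - (n-1)` after `k` rounds. -/
def pathRound (k : ℕ) (C : Fin n → Fin n) : Finset (Sym2 (Fin n)) :=
  ({i | i.val % 2 = k % 2 ∧ i.val + 1 < n ∧ C (next i) < C i} : Finset (Fin n)).image edge

/-- The loop of odd-even sorting on the path with at most `fuel` further rounds. -/
noncomputable def pathLoop : ℕ → ℕ → (Fin n → Fin n) → List (Finset (Sym2 (Fin n)))
  | 0, _, _ => []
  | fuel + 1, k, C =>
    if C = id then []
    else pathRound k C :: pathLoop fuel (k + 1) (route (pathRound k C) C)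

/-- Odd-even sorting on the cycle cut at the edge `{n-1, 0}`: it runs until the tokens are sorted.
Odd-even transposition sort needs at most `n` rounds, so the loop is given `n` rounds. -/
noncomputable def pathOddEven (C : Fin n → Fin n) : List (Finset (Sym2 (Fin n))) :=
  pathLoop n 0 C

/-- The algorithm: the better one of the two outputs. -/
noncomputable def cycleAlg (C : Fin n → Fin n) : List (Finset (Sym2 (Fin n))) :=
  match cycleOddEven C with
  | none => pathOddEven C
  | some L => if (pathOddEven C).length < L.length then pathOddEven C else L

end Cycle

/-! ### A machine model with a step count

Programs of a random access machine in structured form.  A state holds natural numbers in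
registers and in arrays.  Every elementary operation costs one step; the only arithmetic is
addition and (truncated) subtraction, so that a computation of `t` steps cannot form numbers of
more than `O(t)` additional bits, and polynomially many steps are polynomial time in the sense of
Turing machines. -/

/-- The registers, and the cells of the arrays. -/
structure State where
  reg : ℕ → ℕ
  arr : ℕ → ℕ → ℕ

/-- Write the value `v` into the register `x`. -/
def State.setReg (s : State) (x v : ℕ) : State where
  reg y := if y = x then v else s.reg y
  arr := s.arr

/-- Write the value `v` into the cell of the array `a` with the address `i`. -/
def State.setArr (s : State) (a i v : ℕ) : State where
  reg := s.reg
  arr b j := if b = a ∧ j = i then v else s.arr b j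

/-- Expressions; `get a e` reads the cell of the array `a` whose address is the value of `e`. -/
inductive Exp where
  | lit (c : ℕ)
  | reg (x : ℕ)
  | get (a : ℕ) (e : Exp)
  | add (e f : Exp)
  | sub (e f : Exp)
  | lt (e f : Exp)
  | eq (e f : Exp)

/-- The value of an expression; a comparison has the value `1` or `0`. -/
def Exp.eval (s : State) : Exp → ℕ
  | .lit c => c
  | .reg x => s.reg x
  | .get a e => s.arr a (e.eval s)
  | .add e f => e.eval s + f.eval s
  | .sub e f => e.eval s - f.eval s
  | .lt e f => if e.eval s < f.eval s then 1 else 0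
  | .eq e f => if e.eval s = f.eval s then 1 else 0

/-- The number of steps needed to evaluate an expression: its number of nodes. -/
def Exp.cost : Exp → ℕ
  | .lit _ => 1
  | .reg _ => 1
  | .get _ e => e.cost + 1
  | .add e f => e.cost + f.cost + 1
  | .sub e f => e.cost + f.cost + 1
  | .lt e f => e.cost + f.cost + 1
  | .eq e f => e.cost + f.cost + 1

/-- Programs. `put a e f` writes the value of `f` into the array `a` at the address `e`. -/
inductive Prog where
  | skip
  | assign (x : ℕ) (e : Exp)
  | put (a : ℕ) (e f : Exp)
  | seq (p q : Prog)
  | cond (e : Exp) (p q : Prog)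
  | loop (e : Exp) (p : Prog)

/-- `Exec p s t s'`: the program `p`, started in the state `s`, halts after exactly `t` steps in
the state `s'`. A condition holds if its value is not `0`. -/
inductive Exec : Prog → State → ℕ → State → Prop
  | skip (s : State) : Exec .skip s 1 s
  | assign (x : ℕ) (e : Exp) (s : State) :
      Exec (.assign x e) s (e.cost + 1) (s.setReg x (e.eval s))
  | put (a : ℕ) (e f : Exp) (s : State) :
      Exec (.put a e f) s (e.cost + f.cost + 1)
        (s.setArr a (e.eval s) (f.eval s))
  | seq {p q : Prog} {s s' s'' : State} {t u : ℕ} :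
      Exec p s t s' → Exec q s' u s'' → Exec (.seq p q) s (t + u) s''
  | cond_true {e : Exp} {p q : Prog} {s s' : State} {t : ℕ} :
      e.eval s ≠ 0 → Exec p s t s' → Exec (.cond e p q) s (e.cost + t + 1) s'
  | cond_false {e : Exp} {p q : Prog} {s s' : State} {t : ℕ} :
      e.eval s = 0 → Exec q s t s' → Exec (.cond e p q) s (e.cost + t + 1) s'
  | loop_true {e : Exp} {p : Prog} {s s' s'' : State} {t u : ℕ} :
      e.eval s ≠ 0 → Exec p s t s' → Exec (.loop e p) s' u s'' →
      Exec (.loop e p) s (e.cost + t + u + 1) s''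
  | loop_false {e : Exp} {p : Prog} {s : State} :
      e.eval s = 0 → Exec (.loop e p) s (e.cost + 1) s

/-- The initial state for the configuration `C` on the `n`-cycle: register `0` holds `n`, the
array `0` holds the tokens `C 0, …, C (n-1)`, and everything else is `0`. -/
def input {n : ℕ} (C : Fin n → Fin n) : State where
  reg x := if x = 0 then n else 0
  arr a i := if a = 0 then (if h : i < n then (C ⟨i, h⟩).val else 0) else 0

/-- The state `s` holds the sequence of matchings `L` as output: register `1` holds its length,
and in the array `1` the cell `j * n + i` tells whether the `j`-th matching contains the edge `i`
(both counted from `0`). -/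
def HoldsOutput {n : ℕ} (s : State) (L : List (Finset (Sym2 (Fin n)))) : Prop :=
  s.reg 1 = L.length ∧
    ∀ (j : ℕ) (hj : j < L.length) (i : Fin n),
      s.arr 1 (j * n + i.val) = if edge i ∈ L[j] then 1 else 0

/-- The map `A` from configurations on cycles to sequences of matchings is computed by one program
in time polynomial in the number `n ≥ 3` of vertices. -/
def PolyTimeOnCycles
    (A : (n : ℕ) → Equiv.Perm (Fin n) → List (Finset (Sym2 (Fin n)))) : Prop :=
  ∃ (P : Prog) (q : Polynomial ℕ), ∀ (n : ℕ), 3 ≤ n → ∀ C : Equiv.Perm (Fin n),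
    ∃ (t : ℕ) (s : State), Exec P (input C) t s ∧ t ≤ q.eval n ∧ HoldsOutput s (A n C)

end PTS

namespace PTS

/-! ### Height functions of maps `ℤ → ℤ` -/

section Heights

/-! Configurations are lifted to maps `π : ℤ → ℤ` and sorted one threshold at a time. For a
threshold `m`, the height at the edge `i` counts the positions `j ≤ i` whose token has a destination
above `m`. A swap along `i` changes the height at `i` only, and the identity has the least heights
of all. One matching can never bring the heights below `fastest W`, and `fastest` is monotone.
Hence, if `k` matchings sort `π`, then `k` iterations of `fastest` reach the sorted heights for
every threshold (`SortableIn`).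

Conversely, swapping an inversion on an active edge brings the height there down to `fastest` at
once. So odd-even sorting follows the iterates of `fastest`, with a delay that depends only on the
schedule: `eq_id_of_levels` turns a count of rounds per edge into a bound on the number of rounds.
The alternating schedule needs `k + 1` rounds (`eq_id_of_alternating`), the four-phase schedule for
odd `n` needs `2 * k + 1` (`eq_id_of_oddPhase`).

On the cycle, let a solution have length `k`. If `k < n / 2`, undoing its matchings from the
identity produces a lift with displacements at most `k` (`exists_lift_of_routeSeq`). While all
displacements stay below `n / 2`, an edge is reasonable exactly if it is an inversion of the lift
(`Lift.reasonable_iff`), and swapping inversions preserves this bound. Thus the cycle algorithm is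
odd-even sorting on `ℤ`, and it stops within `k + 1` or `2 * k + 1` rounds. If `k ≥ n / 2`, path
sorting suffices: it takes at most `n ≤ 2 * k + n % 2` rounds (`traj_pathRound_eq_id`).

For the running time, an explicit program runs both procedures side by side until one of them is
done. Its rounds process the edges one by one, which is harmless because the edges of a matching are
disjoint (`sweep`). There are at most `n` rounds of linear cost, so the program is quadratic
(`runs_algProg`). -/

/-- No two consecutive integers belong to `S`: the edges `{i, i+1}`, `i ∈ S`, form a matching. -/
def Sep (S : Set ℤ) : Prop := ∀ i ∈ S, i + 1 ∉ S

open Classical in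
/-- The involution of `ℤ` that swaps `i` and `i + 1` for all `i ∈ S`. -/
noncomputable def swapMap (S : Set ℤ) (i : ℤ) : ℤ :=
  if i ∈ S then i + 1 else if i - 1 ∈ S then i - 1 else i

lemma swapMap_swapMap {S : Set ℤ} (hS : Sep S) (i : ℤ) : swapMap S (swapMap S i) = i := by
  unfold swapMap
  by_cases h : i ∈ S
  · have := hS i h
    simp [h, this]
  · by_cases h' : i - 1 ∈ S
    · simp [h, h']
    · simp [h, h']

/-- `W i` is the number of `j ≤ i` with `m < π j`; the tails say that `π` is balanced. -/
def IsHeight (π : ℤ → ℤ) (m : ℤ) (W : ℤ → ℤ) : Prop :=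
  (∀ i, W i = W (i - 1) + if m < π i then 1 else 0) ∧
    ∃ B, (∀ i ≤ -B, W i = 0) ∧ ∀ i ≥ B, W i = i - m

open Classical in
/-- The effect of swaps on a height function. -/
noncomputable def swapHeight (S : Set ℤ) (W : ℤ → ℤ) (i : ℤ) : ℤ :=
  if i ∈ S then W (i - 1) + W (i + 1) - W i else W i

/-- One step of the fastest conceivable sorting, in terms of height functions. -/
def fastest (W : ℤ → ℤ) (i : ℤ) : ℤ := max (W (i - 1)) (W (i + 1) - 1)

lemma IsHeight.bounds {π : ℤ → ℤ} {m : ℤ} {W : ℤ → ℤ} (h : IsHeight π m W) (i : ℤ) :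
    W (i - 1) ≤ W i ∧ W i ≤ W (i - 1) + 1 ∧ W i ≤ W (i + 1) ∧ W (i + 1) ≤ W i + 1 := by
  have h1 := h.1 i
  have h2 := h.1 (i + 1)
  rw [add_sub_cancel_right] at h2
  split_ifs at h1 h2 <;> omega

/-- A swap along `i` exchanges the increments of `W` at `i` and `i + 1`. Every other prefix keeps
its set of tokens, so only the value at `i` changes. -/
lemma IsHeight.swap {π : ℤ → ℤ} {m : ℤ} {W : ℤ → ℤ} (h : IsHeight π m W) {S : Set ℤ}
    (hS : Sep S) : IsHeight (π ∘ swapMap S) m (swapHeight S W) := by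
  refine ⟨fun i => ?_, ?_⟩
  · have h0 := h.1 (i - 1)
    have h1 := h.1 i
    have h2 := h.1 (i + 1)
    rw [add_sub_cancel_right] at h2
    by_cases hi : i ∈ S
    · have hi1 : i - 1 ∉ S := fun hh => by simpa [hi] using hS _ hh
      simp only [Function.comp, swapMap, swapHeight, hi, hi1, if_true, if_false]
      omega
    · by_cases hi1 : i - 1 ∈ S
      · simp only [Function.comp, swapMap, swapHeight, hi, hi1, if_true, if_false,
          sub_add_cancel]
        omega
      · simp only [Function.comp, swapMap, swapHeight, hi, hi1, if_false]
        omega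
  · obtain ⟨B, hB1, hB2⟩ := h.2
    refine ⟨B + 1, fun i hi => ?_, fun i hi => ?_⟩
    · unfold swapHeight
      rw [hB1 i (by omega), hB1 (i - 1) (by omega), hB1 (i + 1) (by omega)]
      simp
    · unfold swapHeight
      rw [hB2 i (by omega), hB2 (i - 1) (by omega), hB2 (i + 1) (by omega)]
      split_ifs <;> omega

lemma swapHeight_swapHeight {S : Set ℤ} (hS : Sep S) (W : ℤ → ℤ) :
    swapHeight S (swapHeight S W) = W := by
  funext i
  by_cases hi : i ∈ S
  · have hi1 : i - 1 ∉ S := fun hh => by simpa [hi] using hS _ hh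
    simp [swapHeight, hi, hi1, hS i hi]
  · simp [swapHeight, hi]

lemma fastest_mono : Monotone fastest := fun _ _ h _ =>
  max_le_max (h _) (sub_le_sub_right (h _) _)

/-- Increments are `0` or `1`, so neither `W i` nor its exchanged value can fall below `W (i - 1)`
or `W (i + 1) - 1`. This is the speed limit for arbitrary matchings. -/
lemma IsHeight.fastest_le_swapHeight {π : ℤ → ℤ} {m : ℤ} {W : ℤ → ℤ} (h : IsHeight π m W)
    (S : Set ℤ) : fastest W ≤ swapHeight S W := by
  intro i
  change fastest W i ≤ swapHeight S W i
  have := h.bounds i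
  unfold fastest swapHeight
  split_ifs <;> omega

lemma IsHeight.fastest_le {π : ℤ → ℤ} {m : ℤ} {W : ℤ → ℤ} (h : IsHeight π m W) :
    fastest W ≤ W := by
  intro i
  change fastest W i ≤ W i
  have := h.bounds i
  unfold fastest
  omega

lemma IsHeight.antitone_fastest {π : ℤ → ℤ} {m : ℤ} {W : ℤ → ℤ} (h : IsHeight π m W) :
    Antitone fun k => fastest^[k] W :=
  fastest_mono.antitone_iterate_of_map_le h.fastest_le

/-! ### Swapping inversions -/

/-- The inversions of `π` among the edges in `P`. -/
def inversions (P : Set ℤ) (π : ℤ → ℤ) : Set ℤ := {i | i ∈ P ∧ π (i + 1) < π i}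

lemma Sep.inversions {P : Set ℤ} (hP : Sep P) (π : ℤ → ℤ) : Sep (inversions P π) :=
  fun i hi h => hP i hi.1 h.1

lemma IsHeight.swapHeight_inversions_le {π : ℤ → ℤ} {m : ℤ} {W : ℤ → ℤ} (h : IsHeight π m W)
    (P : Set ℤ) : swapHeight (inversions P π) W ≤ W := by
  intro i
  change _ ≤ W i
  have h1 := h.1 i
  have h2 := h.1 (i + 1)
  rw [add_sub_cancel_right] at h2
  unfold swapHeight
  by_cases hi : i ∈ inversions P π
  · have := hi.2
    rw [if_pos hi]
    split_ifs at h1 h2 <;> omega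
  · rw [if_neg hi]

/-- The value at `i` can fall only if the increments at `i` and `i + 1` are `1, 0`. Then `π (i + 1)
≤ m < π i`, so the edge is an inversion and the swap attains the speed limit. For all other
increments `fastest W i = W i`. -/
lemma IsHeight.swapHeight_inversions_le_fastest {π : ℤ → ℤ} {m : ℤ} {W : ℤ → ℤ}
    (h : IsHeight π m W) {P : Set ℤ} {i : ℤ} (hi : i ∈ P) :
    swapHeight (inversions P π) W i ≤ fastest W i := by
  have h1 := h.1 i
  have h2 := h.1 (i + 1)
  rw [add_sub_cancel_right] at h2
  unfold swapHeight fastest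
  by_cases h' : π (i + 1) < π i
  · rw [if_pos (show i ∈ inversions P π from ⟨hi, h'⟩)]
    split_ifs at h1 h2 <;> omega
  · rw [if_neg (show i ∉ inversions P π from fun hh => h' hh.2)]
    split_ifs at h1 h2 <;> omega

/-- `W` is nondecreasing and `W j - j` is nonincreasing; the left tail bounds the first from below,
the right tail the second. -/
lemma IsHeight.sorted_le {π : ℤ → ℤ} {m : ℤ} {W : ℤ → ℤ} (h : IsHeight π m W) (i : ℤ) :
    max 0 (i - m) ≤ W i := by
  obtain ⟨B, hB1, hB2⟩ := h.2
  have hmono : Monotone W := monotone_int_of_le_succ fun j => (h.bounds j).2.2.1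
  have hanti : Antitone fun j => W j - j := antitone_int_of_succ_le fun j => by
    have := (h.bounds j).2.2.2
    omega
  have h1 := hmono (min_le_left i (-B))
  rw [hB1 _ (min_le_right _ _)] at h1
  have h2 := hanti (le_max_left i B)
  have h3 := hB2 _ (le_max_right i B)
  simp only at h2
  omega

lemma eq_id_of_heights {π : ℤ → ℤ}
    (h : ∀ m, ∃ W, IsHeight π m W ∧ ∀ i, W i ≤ max 0 (i - m)) : π = id := by
  have key : ∀ m i, m < π i ↔ m < i := by
    intro m i
    obtain ⟨W, hW, hle⟩ := h m
    have h1 := hW.1 i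
    have h2 := hW.sorted_le i
    have h3 := hW.sorted_le (i - 1)
    have h4 := hle i
    have h5 := hle (i - 1)
    split_ifs at h1 with hm
    · simp only [hm, true_iff]; omega
    · simp only [hm, false_iff]; omega
  funext i
  have h1 := key i i
  have h2 := key (i - 1) i
  simp only [id]
  omega

lemma isHeight_id (m : ℤ) : IsHeight id m fun i => max 0 (i - m) := by
  refine ⟨fun i => ?_, max m (-m), fun i hi => ?_, fun i hi => ?_⟩
  · simp only [id]
    split_ifs <;> omega
  · simp only
    omega
  · simp only
    omega

/-! ### Comparing schedules with the fastest sorting -/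

/-- Every configuration that some `k` matchings can sort is one that `fastest` sorts in `k`
steps. -/
def SortableIn (k : ℕ) (π : ℤ → ℤ) : Prop :=
  ∀ m, ∃ W, IsHeight π m W ∧ ∀ i, fastest^[k] W i ≤ max 0 (i - m)

lemma sortableIn_id : SortableIn 0 id := fun m => ⟨_, isHeight_id m, fun _ => le_rfl⟩

/-- Repeating the swap restores `W`, so one step of `fastest` from the new heights is already at
most `W`. -/
lemma SortableIn.swap {k : ℕ} {π : ℤ → ℤ} (h : SortableIn k π) {S : Set ℤ} (hS : Sep S) :
    SortableIn (k + 1) (π ∘ swapMap S) := by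
  intro m
  obtain ⟨W, hW, hle⟩ := h m
  refine ⟨swapHeight S W, hW.swap hS, fun i => le_trans ?_ (hle i)⟩
  have h1 := (hW.swap hS).fastest_le_swapHeight S
  rw [swapHeight_swapHeight hS] at h1
  exact fastest_mono.iterate k h1 i

/-- Odd-even sorting with the edges `P t` in round `t`. If `lev t i` is a lower bound for the
progress at the edge `i` after `t` rounds, then the sequence is sorted as soon as all levels are
at least the number of steps which `fastest` needs. -/
theorem eq_id_of_levels {P : ℕ → Set ℤ} (hP : ∀ t, Sep (P t)) {π : ℕ → ℤ → ℤ}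
    (hπ : ∀ t, π (t + 1) = π t ∘ swapMap (inversions (P t) (π t))) {lev : ℕ → ℤ → ℕ}
    (h0 : ∀ i, lev 0 i = 0)
    (hact : ∀ t, ∀ i ∈ P t, lev (t + 1) i ≤ lev t (i - 1) + 1 ∧ lev (t + 1) i ≤ lev t (i + 1) + 1)
    (hina : ∀ t, ∀ i ∉ P t, lev (t + 1) i ≤ lev t i)
    {k N : ℕ} (hk : SortableIn k (π 0)) (hN : ∀ i, k ≤ lev N i) : π N = id := by
  apply eq_id_of_heights
  intro m
  obtain ⟨W, hW, hle⟩ := hk m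
  have key : ∀ t, ∃ V, IsHeight (π t) m V ∧ ∀ i, V i ≤ fastest^[lev t i] W i := by
    intro t
    induction t with
    | zero => exact ⟨W, hW, fun i => by simp [h0]⟩
    | succ t ih =>
      obtain ⟨V, hV, hVle⟩ := ih
      refine ⟨swapHeight (inversions (P t) (π t)) V, ?_, fun i => ?_⟩
      · rw [hπ t]
        exact hV.swap ((hP t).inversions _)
      · by_cases hi : i ∈ P t
        · refine (hV.swapHeight_inversions_le_fastest hi).trans ?_
          obtain ⟨ha, hb⟩ := hact t i hi
          -- Both neighbours have reached level `l`; as `fastest` reads only the neighbours, the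
          -- active edge `i` reaches level `l + 1`.
          obtain ⟨l, hl⟩ : ∃ l, l = min (lev t (i - 1)) (lev t (i + 1)) := ⟨_, rfl⟩
          have h1 : fastest^[l + 1] W i ≤ fastest^[lev (t + 1) i] W i :=
            hW.antitone_fastest (show lev (t + 1) i ≤ l + 1 by omega) i
          refine le_trans ?_ h1
          rw [Function.iterate_succ_apply']
          have h2 := (hVle (i - 1)).trans
            (hW.antitone_fastest (show l ≤ lev t (i - 1) by omega) (i - 1))
          have h3 := (hVle (i + 1)).trans
            (hW.antitone_fastest (show l ≤ lev t (i + 1) by omega) (i + 1))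
          exact max_le_max h2 (sub_le_sub_right h3 _)
        · refine (hV.swapHeight_inversions_le _ i).trans ((hVle i).trans ?_)
          exact hW.antitone_fastest (hina t i hi) i
  obtain ⟨V, hV, hVle⟩ := key N
  exact ⟨V, hV, fun i => (hVle i).trans ((hW.antitone_fastest (hN i) i).trans (hle i))⟩

lemma eq_id_of_alternating {π : ℕ → ℤ → ℤ}
    (hπ : ∀ t : ℕ, π (t + 1) = π t ∘ swapMap (inversions {i | i % 2 = (t : ℤ) % 2} (π t)))
    {k : ℕ} (hk : SortableIn k (π 0)) : π (k + 1) = id := by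
  -- The edges that have just been active are at level `t`, those whose turn comes next are one
  -- behind. This lag costs the one extra round.
  refine eq_id_of_levels (P := fun t => {i | i % 2 = (t : ℤ) % 2})
    (lev := fun t i => if i % 2 = (t : ℤ) % 2 then t - 1 else t) (fun t i hi h => ?_) hπ
    (fun i => by simp) (fun t i hi => ?_) (fun t i hi => ?_) hk (fun i => ?_)
  · simp only [Set.mem_ofPred_eq] at hi h
    omega
  · simp only [Set.mem_ofPred_eq] at hi
    push_cast
    split_ifs <;> omega
  · simp only [Set.mem_ofPred_eq] at hi
    push_cast
    split_ifs <;> omega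
  · split_ifs <;> omega

/-- The schedule of the cycle odd-even algorithm for odd `n`, lifted to `ℤ`. -/
def oddPhase (n : ℕ) (t : ℕ) : Set ℤ :=
  {i | if t % 4 = 0 then (i % n) % 2 = 0 ∧ i % n + 1 < n
    else if t % 4 = 2 then (i % n) % 2 = 1 else i % n + 1 = n}

lemma emod_add_one {n : ℕ} (hn : 2 ≤ n) (i : ℤ) :
    (i + 1) % n = if i % n + 1 = n then 0 else i % n + 1 := by
  have h0 := Int.emod_nonneg i (show (n : ℤ) ≠ 0 by omega)
  have h1 := Int.emod_lt_of_pos i (show (0 : ℤ) < n by omega)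
  rw [Int.add_emod, Int.emod_eq_of_lt (a := 1) (by omega) (by omega)]
  split_ifs with h
  · rw [h, Int.emod_self]
  · exact Int.emod_eq_of_lt (by omega) (by omega)

lemma emod_sub_one {n : ℕ} (hn : 2 ≤ n) (i : ℤ) :
    (i - 1) % n = if i % n = 0 then (n : ℤ) - 1 else i % n - 1 := by
  have h := emod_add_one hn (i - 1)
  have h0 := Int.emod_nonneg (i - 1) (show (n : ℤ) ≠ 0 by omega)
  rw [sub_add_cancel] at h
  split_ifs at h ⊢ <;> omega

lemma sep_oddPhase {n : ℕ} (hn : 3 ≤ n) (ho : n % 2 = 1) (t : ℕ) : Sep (oddPhase n t) := by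
  intro i hi h
  simp only [oddPhase, Set.mem_ofPred_eq] at hi h
  rw [emod_add_one (by omega)] at h
  have h0 := Int.emod_nonneg i (show (n : ℤ) ≠ 0 by omega)
  have h1 := Int.emod_lt_of_pos i (show (0 : ℤ) < n by omega)
  generalize i % (n : ℤ) = a at *
  split_ifs at hi h <;> omega

/-- The progress of the schedule `oddPhase` at the edge `i` after `t` rounds. -/
def oddLevel (n : ℕ) (t : ℕ) (i : ℤ) : ℕ :=
  if i % n + 1 = n then t / 2
  else if (i % n) % 2 = 0 then
    (if t % 4 = 0 then t / 2 - 1 else if t % 4 = 3 then t / 2 else (t + 1) / 2)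
  else (if t % 4 = 2 then t / 2 - 1 else if t % 4 = 1 then t / 2 else (t + 1) / 2)

lemma oddLevel_active {n : ℕ} (hn : 3 ≤ n) (ho : n % 2 = 1) (t : ℕ) (i : ℤ)
    (hi : i ∈ oddPhase n t) : oddLevel n (t + 1) i ≤ oddLevel n t (i - 1) + 1 ∧
      oddLevel n (t + 1) i ≤ oddLevel n t (i + 1) + 1 := by
  simp only [oddPhase, Set.mem_ofPred_eq] at hi
  simp only [oddLevel]
  rw [emod_add_one (by omega), emod_sub_one (by omega)]
  have h0 := Int.emod_nonneg i (show (n : ℤ) ≠ 0 by omega)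
  have h1 := Int.emod_lt_of_pos i (show (0 : ℤ) < n by omega)
  generalize i % (n : ℤ) = a at *
  split_ifs at hi <;> constructor <;> split_ifs <;> omega

lemma oddLevel_inactive {n : ℕ} (hn : 3 ≤ n) (t : ℕ) (i : ℤ)
    (hi : i ∉ oddPhase n t) : oddLevel n (t + 1) i ≤ oddLevel n t i := by
  simp only [oddPhase, Set.mem_ofPred_eq] at hi
  simp only [oddLevel]
  have h0 := Int.emod_nonneg i (show (n : ℤ) ≠ 0 by omega)
  have h1 := Int.emod_lt_of_pos i (show (0 : ℤ) < n by omega)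
  generalize i % (n : ℤ) = a at *
  split_ifs at hi <;> split_ifs <;> omega

/-- Every four rounds raise all levels by two; after `2 * k + 1` rounds the slowest edges are at
level `k`. -/
lemma eq_id_of_oddPhase {n : ℕ} (hn : 3 ≤ n) (ho : n % 2 = 1) {π : ℕ → ℤ → ℤ}
    (hπ : ∀ t : ℕ, π (t + 1) = π t ∘ swapMap (inversions (oddPhase n t) (π t)))
    {k : ℕ} (hk : SortableIn k (π 0)) : π (2 * k + 1) = id := by
  refine eq_id_of_levels (P := oddPhase n) (lev := oddLevel n) (sep_oddPhase hn ho) hπ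
    (fun i => by simp [oddLevel]) (oddLevel_active hn ho) (oddLevel_inactive hn) hk (fun i => ?_)
  unfold oddLevel
  split_ifs <;> omega

end Heights

/-! ### Matchings of the cycle -/

section Matchings

variable {V : Type*} {G : SimpleGraph V} {M : Finset (Sym2 V)}

/-- The partner chosen by `route` is unique because `M` is a matching. -/
lemma route_of_mem (hM : IsMatching G M) (C : V → V) {v w : V} (h : s(v, w) ∈ M) :
    route M C v = C w := by
  have hex : ∃ w, s(v, w) ∈ M := ⟨w, h⟩
  unfold route
  rw [dif_pos hex]
  have := hM.2 _ hex.choose_spec _ h v (Sym2.mem_mk_left _ _) (Sym2.mem_mk_left _ _)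
  rw [Sym2.congr_right.1 this]

lemma route_of_forall_notMem (C : V → V) {v : V} (h : ∀ w, s(v, w) ∉ M) :
    route M C v = C v := by
  unfold route
  rw [dif_neg (by simpa using h)]

lemma route_empty (C : V → V) : route ∅ C = C := by
  funext v
  exact route_of_forall_notMem C (by simp)

variable {n : ℕ}

lemma next_val (i : Fin n) : (next i).val = if i.val + 1 = n then 0 else i.val + 1 := by
  have := i.isLt
  unfold next
  split_ifs with h
  · simp [h]
  · exact Nat.mod_eq_of_lt (by omega)

lemma next_injective : Function.Injective (next : Fin n → Fin n) := by
  intro i j h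
  have h' := congrArg Fin.val h
  rw [next_val, next_val] at h'
  apply Fin.ext
  split_ifs at h' <;> omega

lemma next_surjective : Function.Surjective (next : Fin n → Fin n) :=
  Finite.surjective_of_injective next_injective

lemma edge_injective (hn : 3 ≤ n) : Function.Injective (edge : Fin n → Sym2 (Fin n)) := by
  intro i j h
  simp only [edge, Sym2.eq_iff] at h
  obtain h | h := h
  · exact h.1
  · have h1 := congrArg Fin.val h.1
    have h2 := congrArg Fin.val h.2
    have := i.isLt
    have := j.isLt
    rw [next_val] at h1 h2
    split_ifs at h1 h2 <;> omega

lemma cycleGraph_adj_iff (hn : 3 ≤ n) (u v : Fin n) :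
    (SimpleGraph.cycleGraph n).Adj u v ↔ v = next u ∨ u = next v := by
  obtain ⟨m, rfl⟩ : ∃ m, n = m + 2 := ⟨n - 2, by omega⟩
  have key : ∀ i : Fin (m + 2), next i = i + 1 := by
    intro i
    apply Fin.ext
    rw [Fin.val_add]
    simp [next]
  rw [SimpleGraph.cycleGraph_adj, key, key, sub_eq_iff_eq_add, sub_eq_iff_eq_add, or_comm,
    add_comm 1 u, add_comm 1 v]

lemma mem_cycleGraph_edgeSet (hn : 3 ≤ n) (e : Sym2 (Fin n)) :
    e ∈ (SimpleGraph.cycleGraph n).edgeSet ↔ ∃ i, edge i = e := by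
  induction e with | _ u v =>
  rw [SimpleGraph.mem_edgeSet, cycleGraph_adj_iff hn]
  constructor
  · rintro (rfl | rfl)
    · exact ⟨u, rfl⟩
    · exact ⟨v, Sym2.eq_swap⟩
  · rintro ⟨i, hi⟩
    obtain ⟨rfl, rfl⟩ | ⟨rfl, rfl⟩ := Sym2.eq_iff.1 hi
    · exact Or.inl rfl
    · exact Or.inr rfl

lemma isMatching_image_edge (hn : 3 ≤ n) {S : Finset (Fin n)} (hS : ∀ i ∈ S, next i ∉ S) :
    IsMatching (SimpleGraph.cycleGraph n) (S.image edge) := by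
  refine ⟨fun e he => ?_, fun e he f hf v hve hvf => ?_⟩
  · obtain ⟨i, -, rfl⟩ := Finset.mem_image.1 he
    exact (mem_cycleGraph_edgeSet hn _).2 ⟨i, rfl⟩
  · obtain ⟨i, hi, rfl⟩ := Finset.mem_image.1 he
    obtain ⟨j, hj, rfl⟩ := Finset.mem_image.1 hf
    simp only [edge, Sym2.mem_iff] at hve hvf
    obtain rfl | rfl := hve
    · obtain rfl | h := hvf
      · rfl
      · exact absurd (h ▸ hi) (hS j hj)
    · obtain h | h := hvf
      · exact absurd (h ▸ hj) (hS i hi)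
      · rw [next_injective h]

lemma IsMatching.edge_next_notMem (hn : 3 ≤ n) {M : Finset (Sym2 (Fin n))}
    (hM : IsMatching (SimpleGraph.cycleGraph n) M) {i : Fin n} (hi : edge i ∈ M) :
    edge (next i) ∉ M := by
  intro h
  have h1 := edge_injective hn (hM.2 _ hi _ h (next i) (Sym2.mem_mk_right _ _)
    (Sym2.mem_mk_left _ _))
  have h2 := next_val i
  rw [← h1] at h2
  split_ifs at h2 <;> omega

lemma route_self {M : Finset (Sym2 (Fin n))}
    (hM : IsMatching (SimpleGraph.cycleGraph n) M) (C : Fin n → Fin n) {i : Fin n}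
    (hi : edge i ∈ M) : route M C i = C (next i) :=
  route_of_mem hM C hi

lemma route_next {M : Finset (Sym2 (Fin n))}
    (hM : IsMatching (SimpleGraph.cycleGraph n) M) (C : Fin n → Fin n) {i : Fin n}
    (hi : edge i ∈ M) : route M C (next i) = C i :=
  route_of_mem hM C (by rwa [Sym2.eq_swap])

lemma route_next_of_notMem (hn : 3 ≤ n) {M : Finset (Sym2 (Fin n))}
    (hM : IsMatching (SimpleGraph.cycleGraph n) M) (C : Fin n → Fin n) {i : Fin n}
    (h1 : edge i ∉ M) (h2 : edge (next i) ∉ M) : route M C (next i) = C (next i) := by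
  refine route_of_forall_notMem C fun w hw => ?_
  obtain ⟨j, hj⟩ := (mem_cycleGraph_edgeSet hn _).1 (hM.1 _ hw)
  rw [← hj] at hw
  obtain ⟨rfl, -⟩ | ⟨-, h⟩ := Sym2.eq_iff.1 hj
  · exact h2 hw
  · exact h1 (next_injective h ▸ hw)

end Matchings

/-! ### Lifting configurations on the cycle to `ℤ` -/

section Lift

variable (n : ℕ) [NeZero n]

/-- The vertex of the cycle below the integer `i`. -/
def toFin (i : ℤ) : Fin n :=
  ⟨(i % n).toNat, by
    have := Int.emod_lt_of_pos i (show (0 : ℤ) < n by exact_mod_cast NeZero.pos n)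
    have := NeZero.pos n
    omega⟩

lemma toFin_val (i : ℤ) : ((toFin n i).val : ℤ) = i % n :=
  Int.toNat_of_nonneg (Int.emod_nonneg i (by exact_mod_cast NeZero.ne n))

lemma toFin_eq_iff {i j : ℤ} : toFin n i = toFin n j ↔ i % n = j % n := by
  rw [← toFin_val, ← toFin_val, Fin.ext_iff, Nat.cast_inj]

lemma toFin_coe (v : Fin n) : toFin n (v.val : ℤ) = v := by
  have h := toFin_val n v.val
  rw [Int.emod_eq_of_lt (by omega) (by have := v.isLt; omega)] at h
  exact Fin.ext (by exact_mod_cast h)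

lemma next_toFin (i : ℤ) : next (toFin n i) = toFin n (i + 1) := by
  have h : ((next (toFin n i)).val : ℤ) = ((toFin n (i + 1)).val : ℤ) := by
    rw [toFin_val]
    simp only [next]
    push_cast
    rw [toFin_val, Int.emod_add_emod]
  exact Fin.ext (by exact_mod_cast h)

lemma toFin_add_period (i : ℤ) : toFin n (i + n) = toFin n i := by
  rw [toFin_eq_iff, Int.add_emod_right]

variable {n}

/-- `π` is a lift of the configuration `C` to the universal cover of the cycle. -/
structure Lift (C : Fin n → Fin n) (π : ℤ → ℤ) : Prop where
  map : ∀ i, C (toFin n i) = toFin n (π i)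
  period : ∀ i, π (i + n) = π i + n

/-- The lifts of the edges in `M`. -/
def liftEdges (M : Finset (Sym2 (Fin n))) : Set ℤ := {i | edge (toFin n i) ∈ M}

lemma sep_liftEdges (hn : 3 ≤ n) {M : Finset (Sym2 (Fin n))}
    (hM : IsMatching (SimpleGraph.cycleGraph n) M) : Sep (liftEdges M) := by
  intro i hi h
  rw [liftEdges, Set.mem_ofPred_eq, ← next_toFin] at h
  exact hM.edge_next_notMem hn hi h

lemma route_toFin (hn : 3 ≤ n) {M : Finset (Sym2 (Fin n))}
    (hM : IsMatching (SimpleGraph.cycleGraph n) M) (C : Fin n → Fin n) (i : ℤ) :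
    route M C (toFin n i) = C (toFin n (swapMap (liftEdges M) i)) := by
  have hnext : toFin n i = next (toFin n (i - 1)) := by rw [next_toFin, sub_add_cancel]
  unfold swapMap
  by_cases h : i ∈ liftEdges M
  · rw [if_pos h, route_self hM C h, next_toFin]
  · by_cases h' : i - 1 ∈ liftEdges M
    · rw [if_neg h, if_pos h', hnext, route_next hM C h']
    · rw [if_neg h, if_neg h', hnext]
      exact route_next_of_notMem hn hM C h' (by rw [← hnext]; exact h)

lemma Lift.route (hn : 3 ≤ n) {M : Finset (Sym2 (Fin n))}
    (hM : IsMatching (SimpleGraph.cycleGraph n) M) {C : Fin n → Fin n} {π : ℤ → ℤ}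
    (h : Lift C π) : Lift (route M C) (π ∘ swapMap (liftEdges M)) := by
  refine ⟨fun i => ?_, fun i => ?_⟩
  · rw [route_toFin hn hM, h.map, Function.comp]
  · have h1 : i + n ∈ liftEdges M ↔ i ∈ liftEdges M := by
      simp only [liftEdges, Set.mem_ofPred_eq, toFin_add_period]
    have h2 : i + n - 1 ∈ liftEdges M ↔ i - 1 ∈ liftEdges M := by
      rw [add_sub_right_comm]
      simp only [liftEdges, Set.mem_ofPred_eq, toFin_add_period]
    have h3 : swapMap (liftEdges M) (i + n) = swapMap (liftEdges M) i + n := by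
      unfold swapMap
      by_cases h3 : i ∈ liftEdges M
      · rw [if_pos h3, if_pos (h1.2 h3)]
        ring
      · rw [if_neg h3, if_neg (mt h1.1 h3)]
        by_cases h4 : i - 1 ∈ liftEdges M
        · rw [if_pos h4, if_pos (h2.2 h4)]
          ring
        · rw [if_neg h4, if_neg (mt h2.1 h4)]
    simp only [Function.comp]
    rw [h3, h.period]

lemma lift_id : Lift (id : Fin n → Fin n) id := ⟨fun _ => rfl, fun _ => rfl⟩

lemma Lift.eq_id {C : Fin n → Fin n} (h : Lift C id) : C = id := by
  funext v
  have := h.map v.val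
  rwa [toFin_coe, id, toFin_coe] at this

lemma abs_swapMap_sub_le (S : Set ℤ) (i : ℤ) : |swapMap S i - i| ≤ 1 := by
  unfold swapMap
  split_ifs <;> simp

/-- The lift is built backwards from the identity by undoing the matchings. Each one changes
displacements by at most one and uses up one step of `SortableIn`. -/
lemma exists_lift_of_routeSeq (hn : 3 ≤ n) (L : List (Finset (Sym2 (Fin n))))
    (C : Fin n → Fin n) (hL : IsSolution (SimpleGraph.cycleGraph n) C L) :
    ∃ π, Lift C π ∧ (∀ i, |π i - i| ≤ L.length) ∧ SortableIn L.length π := by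
  induction L generalizing C with
  | nil =>
    obtain rfl : C = id := hL.2
    exact ⟨id, lift_id, by simp, sortableIn_id⟩
  | cons M L ih =>
    have hM := hL.1 M List.mem_cons_self
    have hS := sep_liftEdges hn hM
    obtain ⟨π, h1, h2, h3⟩ := ih (PTS.route M C)
      ⟨fun N hN => hL.1 N (List.mem_cons_of_mem _ hN), hL.2⟩
    refine ⟨π ∘ swapMap (liftEdges M), ?_, fun i => ?_, h3.swap hS⟩
    · have h4 := h1.route hn hM
      have h5 : PTS.route M (PTS.route M C) = C := by
        funext v
        rw [← toFin_coe n v, route_toFin hn hM, route_toFin hn hM, swapMap_swapMap hS]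
      rwa [h5] at h4
    · have h4 := h2 (swapMap (liftEdges M) i)
      have h5 := abs_swapMap_sub_le (liftEdges M) i
      rw [abs_le] at *
      simp only [Function.comp, List.length_cons]
      push_cast
      omega

lemma pathPos_toFin (c v : ℤ) (k : ℕ) (hc : (k : ℤ) = c) (hk : k < n) :
    ((pathPos n k (toFin n v).val : ℕ) : ℤ) = (v + (n - 1 - c)) % n := by
  unfold pathPos
  push_cast
  rw [toFin_val, Nat.cast_sub (by omega), Nat.cast_sub (by omega), hc, Int.emod_add_emod]
  simp

/-- Cutting the opposite edge leaves a path that lifts to a window of `n` consecutive integers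
around `i`. The strict displacement bound puts both `π i` and `π (i + 1)` into this window, where
`pathPos` is a translation and so preserves the order. -/
lemma Lift.reasonable_iff {C : Fin n → Fin n} {π : ℤ → ℤ} (h : Lift C π)
    (hd : ∀ i, |π i - i| < (n / 2 : ℕ)) (i : ℤ) :
    Reasonable C (toFin n i) ↔ π (i + 1) < π i := by
  have hi := toFin_val n i
  obtain ⟨a, ha⟩ : ∃ a, a = (toFin n i).val := ⟨_, rfl⟩
  have han : a < n := ha ▸ (toFin n i).isLt
  have hq := Int.emod_add_mul_ediv i n
  have h1 := abs_lt.1 (hd i)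
  have h2 := abs_lt.1 (hd (i + 1))
  rw [← hi, ← ha] at hq
  unfold Reasonable
  rw [next_toFin, h.map, h.map, ← ha, ← Nat.cast_lt (α := ℤ),
    pathPos_toFin _ _ _ rfl (by unfold opposite; split_ifs <;> omega),
    pathPos_toFin _ _ _ rfl (by unfold opposite; split_ifs <;> omega)]
  generalize i / (n : ℤ) = q at hq
  have key : ∀ x y : ℤ, 0 ≤ y - n * q → y - n * q < n → x = y → x % n = y - n * q := by
    intro x y hx hy hxy
    rw [hxy]
    conv_lhs => rw [show y = (y - n * q) + n * q by ring]
    rw [Int.add_mul_emod_self_left, Int.emod_eq_of_lt hx hy]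
  generalize hN : (n : ℤ) * q = N at *
  unfold opposite
  split_ifs with hlt
  · rw [key _ (π (i + 1) + (n - 1 - (a + n / 2 : ℕ))) (by push_cast at *; omega)
      (by push_cast at *; omega) rfl, key _ (π i + (n - 1 - (a + n / 2 : ℕ)))
      (by push_cast at *; omega) (by push_cast at *; omega) rfl]
    omega
  · have key' : ∀ x : ℤ, 0 ≤ x - N → x - N < n → (x + n) % n = x - N := by
      intro x hx hy
      rw [Int.add_emod_right]
      exact key x x hx hy rfl
    -- Here the opposite edge lies before `a`, so the argument of the remainder exceeds its value in
    -- the window by one more period.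
    have e : ∀ x : ℤ, x + (n - 1 - ((a - n / 2 : ℕ) : ℤ)) = (x - 1 - a + (n / 2 : ℕ)) + n := by
      intro x
      rw [Nat.cast_sub (by omega)]
      ring
    rw [e, e, key' _ (by omega) (by omega), key' _ (by omega) (by omega)]
    omega

end Lift

/-! ### Trajectories of the two algorithms -/

section Trajectories

variable {n : ℕ}

/-- The configuration after `k` rounds, if the round `j` uses the matching `F j C`. -/
noncomputable def traj (F : ℕ → (Fin n → Fin n) → Finset (Sym2 (Fin n))) (C : Fin n → Fin n) :
    ℕ → Fin n → Fin n
  | 0 => C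
  | k + 1 => route (F k (traj F C k)) (traj F C k)

/-- The matchings of the first `K` rounds. -/
noncomputable def rounds (F : ℕ → (Fin n → Fin n) → Finset (Sym2 (Fin n))) (C : Fin n → Fin n)
    (K : ℕ) : List (Finset (Sym2 (Fin n))) :=
  (List.range K).map fun j => F j (traj F C j)

variable (F : ℕ → (Fin n → Fin n) → Finset (Sym2 (Fin n))) (C : Fin n → Fin n)

lemma length_rounds (K : ℕ) : (rounds F C K).length = K := by
  simp [rounds]

lemma routeSeq_rounds (K : ℕ) : routeSeq (rounds F C K) C = traj F C K := by
  induction K with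
  | zero => rfl
  | succ K ih =>
    unfold routeSeq rounds at ih ⊢
    rw [List.range_succ, List.map_append, List.foldl_append, ih]
    rfl

lemma isSolution_rounds {G : SimpleGraph (Fin n)} (hF : ∀ k D, IsMatching G (F k D)) {K : ℕ}
    (hK : traj F C K = id) : IsSolution G C (rounds F C K) := by
  refine ⟨fun M hM => ?_, (routeSeq_rounds F C K).trans hK⟩
  obtain ⟨j, -, rfl⟩ := List.mem_map.1 hM
  exact hF _ _

/-! ### The loops, their stopping rules and their trajectories -/

lemma pathLoop_eq {K : ℕ} (hK : traj pathRound C K = id)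
    (hmin : ∀ j < K, traj pathRound C j ≠ id) (fuel k : ℕ) (hk : k ≤ K) (hf : K ≤ k + fuel) :
    pathLoop fuel k (traj pathRound C k) =
      (List.range' k (K - k)).map fun j => pathRound j (traj pathRound C j) := by
  induction fuel generalizing k with
  | zero =>
    obtain rfl : k = K := by omega
    simp [pathLoop]
  | succ fuel ih =>
    unfold pathLoop
    obtain rfl | hlt := hk.eq_or_lt
    · simp [hK]
    · rw [if_neg (hmin k hlt), show K - k = (K - (k + 1)) + 1 by omega, List.range'_succ,
        List.map_cons, ← ih (k + 1) hlt (by omega)]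
      rfl

lemma pathOddEven_eq {K : ℕ} (hK : traj pathRound C K = id)
    (hmin : ∀ j < K, traj pathRound C j ≠ id) (hn : K ≤ n) :
    pathOddEven C = rounds pathRound C K := by
  have := pathLoop_eq C hK hmin n 0 (Nat.zero_le _) (by omega)
  rw [Nat.sub_zero, ← List.range_eq_range'] at this
  exact this

lemma cycleLoop_eq_none (fuel k idle : ℕ)
    (h : ∀ j ≤ k + fuel, traj cycleRound C j ≠ id) :
    cycleLoop fuel k idle (traj cycleRound C k) = none := by
  induction fuel generalizing k idle with
  | zero => simp [cycleLoop, h k (by omega)]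
  | succ fuel ih =>
    have h1 := ih (k + 1) (if cycleRound k (traj cycleRound C k) = ∅ then idle + 1 else 0)
      fun j hj => h j (by omega)
    simp only [traj] at h1
    simp [cycleLoop, h k (by omega), h1]

lemma cyclePhase_add_period (k : ℕ) : cyclePhase n (k + period n) = cyclePhase n k := by
  unfold cyclePhase period
  split_ifs <;> first | rfl | omega

/-- After a whole idle period every phase has been tried on the same configuration, so nothing will
ever change again. This justifies giving up early. -/
lemma traj_eq_of_idle (k : ℕ)
    (h : ∀ j, k ≤ j → j < k + period n → cycleRound j (traj cycleRound C j) = ∅) (i : ℕ) :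
    traj cycleRound C (k + i) = traj cycleRound C k := by
  have hp : 0 < period n := by unfold period; split_ifs <;> omega
  have h1 : ∀ i ≤ period n, traj cycleRound C (k + i) = traj cycleRound C k := by
    intro i
    induction i with
    | zero => simp
    | succ i ih =>
      intro hi
      rw [← add_assoc, traj, h (k + i) (by omega) (by omega), route_empty, ih (by omega)]
  have h2 : ∀ i, cycleRound (k + i) (traj cycleRound C k) = ∅ := by
    intro i
    induction i using Nat.strong_induction_on with
    | _ i ih =>
      by_cases hi : i < period n
      · rw [← h1 i hi.le]
        exact h (k + i) (by omega) (by omega)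
      · have h3 := ih (i - period n) (by omega)
        have h4 := cyclePhase_add_period (n := n) (k + (i - period n))
        rw [show k + (i - period n) + period n = k + i by omega] at h4
        unfold cycleRound at h3 ⊢
        rwa [h4]
  induction i with
  | zero => rfl
  | succ i ih => rw [← add_assoc, traj, ih, h2 i, route_empty]

lemma cycleLoop_eq_some {K : ℕ} (hK : traj cycleRound C K = id)
    (hmin : ∀ j < K, traj cycleRound C j ≠ id) (fuel k idle : ℕ) (hk : k ≤ K) (hf : K ≤ k + fuel)
    (hidle : idle ≤ k)
    (hempty : ∀ j, k - idle ≤ j → j < k → cycleRound j (traj cycleRound C j) = ∅) :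
    cycleLoop fuel k idle (traj cycleRound C k) =
      some ((List.range' k (K - k)).map fun j => cycleRound j (traj cycleRound C j)) := by
  induction fuel generalizing k idle with
  | zero =>
    obtain rfl : k = K := by omega
    simp [cycleLoop, hK]
  | succ fuel ih =>
    unfold cycleLoop
    obtain rfl | hlt := hk.eq_or_lt
    · simp [hK]
    · rw [if_neg (hmin k hlt)]
      simp only
      obtain ⟨d, hd⟩ : ∃ d, d = if cycleRound k (traj cycleRound C k) = ∅ then idle + 1 else 0 :=
        ⟨_, rfl⟩
      rw [← hd]
      have hd1 : d ≤ k + 1 := by split_ifs at hd <;> omega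
      have hd2 : ∀ j, k + 1 - d ≤ j → j < k + 1 → cycleRound j (traj cycleRound C j) = ∅ := by
        intro j hj1 hj2
        split_ifs at hd with h
        · obtain rfl | hj := (Nat.lt_succ_iff.1 hj2).eq_or_lt
          · exact h
          · exact hempty j (by omega) hj
        · omega
      rw [if_neg, show K - k = (K - (k + 1)) + 1 by omega, List.range'_succ,
        List.map_cons]
      · have h1 := ih (k + 1) d hlt (by omega) hd1 hd2
        rw [traj] at h1
        rw [h1]
        rfl
      -- Giving up here would mean that the configuration was already frozen a period ago, hence
      -- equal to the identity reached at `K`, against the minimality of `K`.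
      · intro hle
        have h1 := traj_eq_of_idle C (k + 1 - period n)
          (fun j hj1 hj2 => hd2 j (by omega) (by omega))
        have h2 := h1 (K - (k + 1 - period n))
        rw [show k + 1 - period n + (K - (k + 1 - period n)) = K by omega, hK] at h2
        exact hmin (k + 1 - period n) (by unfold period at *; split_ifs at * <;> omega) h2.symm

lemma cycleOddEven_eq_some {K : ℕ} (hK : traj cycleRound C K = id)
    (hmin : ∀ j < K, traj cycleRound C j ≠ id) (hn : K ≤ n) :
    cycleOddEven C = some (rounds cycleRound C K) := by
  have := cycleLoop_eq_some C hK hmin n 0 0 (Nat.zero_le _) (by omega) le_rfl (by simp)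
  rw [Nat.sub_zero, ← List.range_eq_range'] at this
  exact this

lemma cycleAlg_eq_cycle {K : ℕ} (hK : traj cycleRound C K = id)
    (hc : ∀ j < K, traj cycleRound C j ≠ id) (hp : ∀ j < K, traj pathRound C j ≠ id)
    (hn : traj pathRound C n = id) : cycleAlg C = rounds cycleRound C K := by
  classical
  have hex : ∃ j, traj pathRound C j = id := ⟨n, hn⟩
  have h1 := pathOddEven_eq C (Nat.find_spec hex) (fun j hj => Nat.find_min hex hj)
    (Nat.find_min' hex hn)
  have h2 : K ≤ Nat.find hex := by
    by_contra! h
    exact hp _ h (Nat.find_spec hex)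
  unfold cycleAlg
  rw [cycleOddEven_eq_some C hK hc (h2.trans (Nat.find_min' hex hn)), h1]
  simp only [length_rounds]
  rw [if_neg (by omega)]

lemma cycleAlg_eq_path {K : ℕ} (hK : traj pathRound C K = id)
    (hp : ∀ j < K, traj pathRound C j ≠ id) (hc : ∀ j ≤ K, traj cycleRound C j ≠ id)
    (hn : K ≤ n) : cycleAlg C = rounds pathRound C K := by
  classical
  have h1 := pathOddEven_eq C hK hp hn
  unfold cycleAlg
  by_cases h : ∃ j, j ≤ n ∧ traj cycleRound C j = id
  · rw [cycleOddEven_eq_some C (Nat.find_spec h).2 (fun j hj hid => Nat.find_min h hj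
      ⟨hj.le.trans (Nat.find_spec h).1, hid⟩) (Nat.find_spec h).1, h1]
    simp only [length_rounds]
    rw [if_pos]
    by_contra! hh
    exact hc _ hh (Nat.find_spec h).2
  · push Not at h
    rw [show cycleOddEven C = none from cycleLoop_eq_none C n 0 0 fun j hj => h j (by omega), h1]

/-- The algorithm runs both procedures in parallel until one of them is done. -/
lemma cycleAlg_cases (hn : traj pathRound C n = id) :
    ∃ K ≤ n, (∀ j < K, traj cycleRound C j ≠ id ∧ traj pathRound C j ≠ id) ∧
      (traj cycleRound C K = id ∧ cycleAlg C = rounds cycleRound C K ∨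
        traj cycleRound C K ≠ id ∧ traj pathRound C K = id ∧
          cycleAlg C = rounds pathRound C K) := by
  classical
  have hex : ∃ j, traj cycleRound C j = id ∨ traj pathRound C j = id := ⟨n, Or.inr hn⟩
  obtain ⟨K, hK, hmin⟩ : ∃ K, (traj cycleRound C K = id ∨ traj pathRound C K = id) ∧
      ∀ j < K, ¬(traj cycleRound C j = id ∨ traj pathRound C j = id) :=
    ⟨Nat.find hex, Nat.find_spec hex, fun j hj => Nat.find_min hex hj⟩
  have hKn : K ≤ n := by
    by_contra! h
    exact hmin n h (Or.inr hn)
  push Not at hmin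
  refine ⟨K, hKn, hmin, ?_⟩
  by_cases h : traj cycleRound C K = id
  · exact Or.inl ⟨h, cycleAlg_eq_cycle C h (fun j hj => (hmin j hj).1) (fun j hj => (hmin j hj).2)
      hn⟩
  · have h' := hK.resolve_left h
    refine Or.inr ⟨h, h', cycleAlg_eq_path C h' (fun j hj => (hmin j hj).2) (fun j hj => ?_) hKn⟩
    obtain rfl | hj := hj.eq_or_lt
    · exact h
    · exact (hmin j hj).1

end Trajectories

/-! ### Odd-even sorting on the path -/

section Path

variable {n : ℕ}

lemma next_notMem_cyclePhase {k : ℕ} {i : Fin n} (hn : 3 ≤ n)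
    (hi : i ∈ cyclePhase n k) : next i ∉ cyclePhase n k := by
  intro h
  have h1 := next_val i
  have h2 := i.isLt
  unfold cyclePhase at hi h
  split_ifs at hi h <;>
    simp only [edgesA, edgesB, edgeClosing, Finset.mem_filter, Finset.mem_univ, true_and]
      at hi h <;>
    split_ifs at h1 <;> omega

lemma isMatching_cycleRound (hn : 3 ≤ n) (k : ℕ) (C : Fin n → Fin n) :
    IsMatching (SimpleGraph.cycleGraph n) (cycleRound k C) := by
  refine isMatching_image_edge hn fun i hi h => ?_
  exact next_notMem_cyclePhase hn (Finset.mem_filter.1 hi).1 (Finset.mem_filter.1 h).1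

lemma isMatching_pathRound (hn : 3 ≤ n) (k : ℕ) (C : Fin n → Fin n) :
    IsMatching (SimpleGraph.cycleGraph n) (pathRound k C) := by
  refine isMatching_image_edge hn fun i hi h => ?_
  simp only [Finset.mem_filter, Finset.mem_univ, true_and] at hi h
  have h1 := next_val i
  split_ifs at h1 <;> omega

lemma edge_mem_cycleRound (hn : 3 ≤ n) (k : ℕ) (C : Fin n → Fin n) (i : Fin n) :
    edge i ∈ cycleRound k C ↔ i ∈ cyclePhase n k ∧ Reasonable C i := by
  rw [cycleRound, (edge_injective hn).mem_finset_image, Finset.mem_filter]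

lemma edge_mem_pathRound (hn : 3 ≤ n) (k : ℕ) (C : Fin n → Fin n) (i : Fin n) :
    edge i ∈ pathRound k C ↔ i.val % 2 = k % 2 ∧ i.val + 1 < n ∧ C (next i) < C i := by
  rw [pathRound, (edge_injective hn).mem_finset_image, Finset.mem_filter]
  simp

variable [NeZero n]

/-- The extension of a configuration on the path by the identity on the rest of `ℤ`. -/
def pathLift (C : Fin n → Fin n) (i : ℤ) : ℤ :=
  if 0 ≤ i ∧ i < n then ((C (toFin n i)).val : ℤ) else i

lemma toFin_val_of_lt {i : ℤ} (h0 : 0 ≤ i) (h1 : i < n) : ((toFin n i).val : ℤ) = i := by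
  rw [toFin_val, Int.emod_eq_of_lt h0 h1]

lemma inversions_pathLift_subset {P : Set ℤ} {C : Fin n → Fin n} {i : ℤ}
    (hi : i ∈ inversions P (pathLift C)) : 0 ≤ i ∧ i + 1 < n := by
  have h := hi.2
  have h1 := (C (toFin n i)).isLt
  unfold pathLift at h
  split_ifs at h <;> omega

/-- Since `pathLift` is the identity outside the path, no inversion leaves the path, and a path
round is a round of odd-even sorting on `ℤ`. -/
lemma pathLift_route (hn : 3 ≤ n) (k : ℕ) (C : Fin n → Fin n) :
    pathLift (route (pathRound k C) C) =
      pathLift C ∘ swapMap (inversions {i | i % 2 = (k : ℤ) % 2} (pathLift C)) := by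
  obtain ⟨S, hS⟩ : ∃ S, S = inversions {i | i % 2 = (k : ℤ) % 2} (pathLift C) := ⟨_, rfl⟩
  have hsub : ∀ i ∈ S, 0 ≤ i ∧ i + 1 < n := fun i hi => inversions_pathLift_subset (hS ▸ hi)
  rw [← hS]
  -- The lifted edges are periodic while `S` is not, so they are compared on one window only. It
  -- starts at `-1`, the closing edge, because `swapMap` at `0` looks at `-1`.
  have key : ∀ i : ℤ, -1 ≤ i → i < n → (i ∈ liftEdges (pathRound k C) ↔ i ∈ S) := by
    intro i h0 h1
    rw [liftEdges, Set.mem_ofPred_eq, edge_mem_pathRound hn]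
    by_cases hi : 0 ≤ i ∧ i + 1 < n
    · have h2 := toFin_val_of_lt hi.1 h1
      rw [hS, inversions, Set.mem_ofPred_eq, Set.mem_ofPred_eq, pathLift, pathLift,
        if_pos (by omega), if_pos (by omega), next_toFin, Fin.lt_def]
      omega
    · refine iff_of_false (fun h => hi ?_) fun h => hi (hsub i h)
      have h2 := toFin_val n i
      by_cases h3 : 0 ≤ i
      · rw [toFin_val_of_lt h3 h1] at h2
        have := toFin_val_of_lt h3 h1
        omega
      · obtain rfl : i = -1 := by omega
        have h4 := emod_sub_one (n := n) (by omega) 0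
        rw [Int.zero_emod, if_pos rfl, zero_sub] at h4
        omega
  funext i
  by_cases hi : 0 ≤ i ∧ i < n
  · have h1 : swapMap (liftEdges (pathRound k C)) i = swapMap S i := by
      have ha := key i (by omega) hi.2
      have hb := key (i - 1) (by omega) (by omega)
      unfold swapMap
      by_cases h3 : i ∈ S
      · rw [if_pos h3, if_pos (ha.2 h3)]
      · rw [if_neg h3, if_neg (mt ha.1 h3)]
        by_cases h4 : i - 1 ∈ S
        · rw [if_pos h4, if_pos (hb.2 h4)]
        · rw [if_neg h4, if_neg (mt hb.1 h4)]
    have h2 : 0 ≤ swapMap S i ∧ swapMap S i < n := by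
      unfold swapMap
      split_ifs with h3 h4
      · have := hsub _ h3; omega
      · have := hsub _ h4; omega
      · exact hi
    rw [pathLift, if_pos hi, route_toFin hn (isMatching_pathRound hn k C), h1, Function.comp,
      pathLift, if_pos h2]
  · have h1 : swapMap S i = i := by
      unfold swapMap
      rw [if_neg, if_neg]
      · intro h; have := hsub _ h; omega
      · intro h; have := hsub _ h; omega
    rw [Function.comp, h1, pathLift, pathLift, if_neg hi, if_neg hi]

lemma eq_id_of_pathLift {C : Fin n → Fin n} (h : pathLift C = id) : C = id := by
  funext v
  have h1 := congrFun h v.val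
  rw [pathLift, if_pos (by have := v.isLt; omega), toFin_coe, id] at h1
  exact Fin.ext (by exact_mod_cast h1)

/-- The height is that of the identity plus the partial sums of the excess `a`. The total excess
vanishes because `C` is a bijection. -/
lemma exists_isHeight_pathLift {C : Fin n → Fin n} (hC : Function.Bijective C) (m : ℤ) :
    ∃ W, IsHeight (pathLift C) m W ∧ ∀ i : ℤ, ¬(0 ≤ i ∧ i + 1 < n) → W i = max 0 (i - m) := by
  obtain ⟨a, ha⟩ : ∃ a : Fin n → ℤ, a = fun v => (if m < ((C v).val : ℤ) then (1 : ℤ) else 0) -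
    (if m < (v.val : ℤ) then 1 else 0) := ⟨_, rfl⟩
  obtain ⟨s, hs⟩ : ∃ s : ℤ → ℤ, s = fun i => ∑ v : Fin n, if (v.val : ℤ) ≤ i then a v else 0 :=
    ⟨_, rfl⟩
  have hneg : ∀ i < 0, s i = 0 := by
    intro i hi
    rw [hs]
    exact Finset.sum_eq_zero fun v _ => if_neg (by omega)
  have hpos : ∀ i, (n : ℤ) ≤ i + 1 → s i = 0 := by
    intro i hi
    rw [hs]
    simp only
    rw [Finset.sum_congr rfl fun v _ => if_pos (show (v.val : ℤ) ≤ i by have := v.isLt; omega),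
      ha, Finset.sum_sub_distrib, sub_eq_zero]
    exact hC.sum_comp fun v : Fin n => if m < (v.val : ℤ) then (1 : ℤ) else 0
  have hstep : ∀ i, s i - s (i - 1) = ∑ v : Fin n, if (v.val : ℤ) = i then a v else 0 := by
    intro i
    rw [hs]
    simp only
    rw [← Finset.sum_sub_distrib]
    refine Finset.sum_congr rfl fun v _ => ?_
    split_ifs <;> omega
  have hin : ∀ i : ℤ, 0 ≤ i → i < n → s i - s (i - 1) = a (toFin n i) := by
    intro i h0 h1
    have h2 := toFin_val_of_lt h0 h1
    rw [hstep, Finset.sum_eq_single (toFin n i), if_pos h2]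
    · intro v _ hv
      refine if_neg fun h => hv ?_
      rw [← h, toFin_coe]
    · simp
  have hout : ∀ i : ℤ, ¬(0 ≤ i ∧ i + 1 < n) → s i = 0 := by
    intro i hi
    by_cases h : 0 ≤ i
    · exact hpos i (by omega)
    · exact hneg i (by omega)
  refine ⟨fun i => s i + max 0 (i - m), ⟨fun i => ?_, ?_⟩, fun i hi => ?_⟩
  · simp only
    by_cases h : 0 ≤ i ∧ i < n
    · have h1 := hin i h.1 h.2
      have h2 := toFin_val_of_lt h.1 h.2
      rw [ha] at h1
      simp only [h2] at h1
      rw [show pathLift C i = ((C (toFin n i)).val : ℤ) from if_pos h]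
      split_ifs at h1 ⊢ <;> omega
    · have h1 := hout i (by omega)
      have h2 := hout (i - 1) (by omega)
      rw [show pathLift C i = i from if_neg h, h1, h2]
      split_ifs <;> omega
  · refine ⟨max (n : ℤ) (max m (-m)) + 1, fun i hi => ?_, fun i hi => ?_⟩
    · simp only
      rw [hout i (by omega)]
      omega
    · simp only
      rw [hout i (by omega)]
      omega
  · simp only
    rw [hout i hi, zero_add]

lemma sortableIn_pathLift {C : Fin n → Fin n} (hC : Function.Bijective C) :
    SortableIn (n - 1) (pathLift C) := by
  intro m
  have hn := NeZero.pos n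
  obtain ⟨W, hW, hout⟩ := exists_isHeight_pathLift hC m
  have hmono : Monotone W := monotone_int_of_le_succ fun j => (hW.bounds j).2.2.1
  have hanti : Antitone fun j => W j - j := antitone_int_of_succ_le fun j => by
    have := (hW.bounds j).2.2.2
    omega
  -- For `t = 0` this averages the bounds `n - 1 - m` and `i + 1`, which come from the two ends of
  -- the path. One step of `fastest` lowers the quotient by a half; at `t = n - 1` it is at most
  -- `max 0 (i - m)`.
  have key : ∀ t : ℕ, ∀ i, fastest^[t] W i ≤ max (max 0 (i - m)) ((i + n - m - t) / 2) := by
    intro t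
    induction t with
    | zero =>
      intro i
      simp only [Function.iterate_zero, id]
      by_cases hi : 0 ≤ i ∧ i + 1 < n
      · have h1 := hmono (show i ≤ n - 1 by omega)
        have h2 := hanti (show -1 ≤ i by omega)
        simp only at h2
        rw [hout (n - 1) (by omega)] at h1
        rw [hout (-1) (by omega)] at h2
        push_cast
        omega
      · rw [hout i hi]
        exact le_max_left _ _
    | succ t ih =>
      intro i
      rw [Function.iterate_succ_apply', fastest]
      have h1 := ih (i - 1)
      have h2 := ih (i + 1)
      push_cast
      omega
  refine ⟨W, hW, fun i => (key (n - 1) i).trans ?_⟩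
  rw [Nat.cast_sub (by omega)]
  push_cast
  omega

lemma traj_pathRound_eq_id (hn : 3 ≤ n) {C : Fin n → Fin n} (hC : Function.Bijective C) :
    traj pathRound C n = id := by
  have h := eq_id_of_alternating (π := fun t => pathLift (traj pathRound C t))
    (fun t => pathLift_route hn t _) (sortableIn_pathLift hC)
  rw [show n - 1 + 1 = n by omega] at h
  exact eq_id_of_pathLift h

end Path

/-! ### Odd-even sorting on the cycle -/

section CycleBound

variable {n : ℕ} [NeZero n]

/-- The lift of the trajectory of the cycle odd-even algorithm. -/
noncomputable def liftTraj (P : ℕ → Set ℤ) (π : ℤ → ℤ) : ℕ → ℤ → ℤ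
  | 0 => π
  | t + 1 => liftTraj P π t ∘ swapMap (inversions (P t) (liftTraj P π t))

/-- In an inversion each swapped destination is bounded on one side by its own old displacement and
on the other by that of its partner. -/
lemma abs_swap_inversions_le {P : Set ℤ} {π : ℤ → ℤ} {b : ℤ} (h : ∀ i, |π i - i| < b) (i : ℤ) :
    |(π ∘ swapMap (inversions P π)) i - i| < b := by
  have h0 := abs_lt.1 (h i)
  have h1 := abs_lt.1 (h (i + 1))
  have h2 := abs_lt.1 (h (i - 1))
  rw [Function.comp, abs_lt]
  unfold swapMap
  split_ifs with hi hi'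
  · have := hi.2
    omega
  · have := hi'.2
    rw [sub_add_cancel] at this
    omega
  · exact h0

/-- Both claims go through one induction: the displacement bound identifies reasonable edges with
inversions, and swapping inversions keeps the bound. -/
lemma lift_liftTraj (hn : 3 ≤ n) {P : ℕ → Set ℤ}
    (hP : ∀ t i, i ∈ P t ↔ toFin n i ∈ cyclePhase n t) {C : Fin n → Fin n} {π : ℤ → ℤ}
    (h : Lift C π) (hd : ∀ i, |π i - i| < (n / 2 : ℕ)) (t : ℕ) :
    Lift (traj cycleRound C t) (liftTraj P π t) ∧
      ∀ i, |liftTraj P π t i - i| < (n / 2 : ℕ) := by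
  induction t with
  | zero => exact ⟨h, hd⟩
  | succ t ih =>
    refine ⟨?_, abs_swap_inversions_le ih.2⟩
    have h1 := ih.1.route hn (isMatching_cycleRound hn t (traj cycleRound C t))
    have h2 : liftEdges (cycleRound t (traj cycleRound C t)) =
        inversions (P t) (liftTraj P π t) := by
      ext i
      rw [liftEdges, Set.mem_ofPred_eq, edge_mem_cycleRound hn, ih.1.reasonable_iff ih.2,
        inversions, Set.mem_ofPred_eq, hP]
    rwa [h2] at h1

lemma mem_cyclePhase_of_even (he : n % 2 = 0) (t : ℕ) (i : ℤ) :
    i % 2 = (t : ℤ) % 2 ↔ toFin n i ∈ cyclePhase n t := by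
  have h1 := toFin_val n i
  have h2 : i % n % 2 = i % 2 := Int.emod_emod_of_dvd i (by omega)
  have h3 := (toFin n i).isLt
  unfold cyclePhase
  rw [if_pos he]
  split_ifs <;> simp only [edgesA, edgesB, Finset.mem_filter, Finset.mem_univ, true_and] <;> omega

lemma mem_cyclePhase_of_odd (ho : n % 2 = 1) (t : ℕ) (i : ℤ) :
    i ∈ oddPhase n t ↔ toFin n i ∈ cyclePhase n t := by
  have h1 := toFin_val n i
  unfold cyclePhase oddPhase
  rw [if_neg (by omega), Set.mem_ofPred_eq]
  split_ifs <;>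
    simp only [edgesA, edgesB, edgeClosing, Finset.mem_filter, Finset.mem_univ, true_and] <;>
    omega

lemma traj_cycleRound_eq_id (hn : 3 ≤ n) {C : Fin n → Fin n} {L : List (Finset (Sym2 (Fin n)))}
    (hL : IsSolution (SimpleGraph.cycleGraph n) C L) (hlt : L.length < n / 2) :
    traj cycleRound C (if n % 2 = 0 then L.length + 1 else 2 * L.length + 1) = id := by
  obtain ⟨π, h1, h2, h3⟩ := exists_lift_of_routeSeq hn L C hL
  have h4 : ∀ i, |π i - i| < (n / 2 : ℕ) := fun i => (h2 i).trans_lt (by exact_mod_cast hlt)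
  split_ifs with h
  · have h5 := (lift_liftTraj hn (P := fun t => {i | i % 2 = (t : ℤ) % 2})
      (fun t i => mem_cyclePhase_of_even h t i) h1 h4 (L.length + 1)).1
    rw [eq_id_of_alternating (π := liftTraj _ π) (fun t => rfl) h3] at h5
    exact h5.eq_id
  · have h5 := (lift_liftTraj hn (P := oddPhase n)
      (fun t i => mem_cyclePhase_of_odd (by omega) t i) h1 h4 (2 * L.length + 1)).1
    rw [eq_id_of_oddPhase hn (by omega) (π := liftTraj _ π) (fun t => rfl) h3] at h5
    exact h5.eq_id

lemma isSolution_cycleAlg (hn : 3 ≤ n) {C : Fin n → Fin n} (hC : Function.Bijective C) :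
    IsSolution (SimpleGraph.cycleGraph n) C (cycleAlg C) := by
  obtain ⟨K, -, -, ⟨h1, h2⟩ | ⟨-, h1, h2⟩⟩ := cycleAlg_cases C (traj_pathRound_eq_id hn hC)
  · rw [h2]
    exact isSolution_rounds _ C (isMatching_cycleRound hn) h1
  · rw [h2]
    exact isSolution_rounds _ C (isMatching_pathRound hn) h1

lemma length_cycleAlg_le (hn : 3 ≤ n) {C : Fin n → Fin n} (hC : Function.Bijective C)
    {L : List (Finset (Sym2 (Fin n)))} (hL : IsSolution (SimpleGraph.cycleGraph n) C L) :
    (cycleAlg C).length ≤ 2 * L.length + n % 2 := by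
  obtain ⟨K, hKn, hmin, h⟩ := cycleAlg_cases C (traj_pathRound_eq_id hn hC)
  have hlen : (cycleAlg C).length = K := by
    obtain ⟨-, h2⟩ | ⟨-, -, h2⟩ := h <;> rw [h2, length_rounds]
  rw [hlen]
  by_cases hlt : L.length < n / 2
  · by_cases h0 : L.length = 0
    · rw [List.length_eq_zero_iff] at h0
      subst h0
      have h1 : traj cycleRound C 0 = id := hL.2
      by_contra! h2
      exact (hmin 0 (by omega)).1 h1
    · by_contra! h2
      exact (hmin _ (by split_ifs <;> omega)).1 (traj_cycleRound_eq_id hn hL hlt)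
  · omega

theorem cycleAlg_approximation (hn : 3 ≤ n) {C : Fin n → Fin n} (hC : Function.Bijective C) :
    (cycleAlg C).length ≤ 2 * opt (SimpleGraph.cycleGraph n) C + n % 2 := by
  have hne : {k | ∃ L, IsSolution (SimpleGraph.cycleGraph n) C L ∧ L.length = k}.Nonempty :=
    ⟨_, _, isSolution_cycleAlg hn hC, rfl⟩
  obtain ⟨L, hL, hlen⟩ := Nat.sInf_mem hne
  have := length_cycleAlg_le hn hC hL
  rw [hlen] at this
  exact this

end CycleBound

/-! ### Reasoning about programs -/

section Programs

/-- The result of a program without loops. -/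
def Prog.run : Prog → State → State
  | .skip, s => s
  | .assign x e, s => s.setReg x (e.eval s)
  | .put a e f, s => s.setArr a (e.eval s) (f.eval s)
  | .seq p q, s => q.run (p.run s)
  | .cond e p q, s => if e.eval s = 0 then q.run s else p.run s
  | .loop _ _, s => s

/-- The program contains no loop. -/
def Prog.LoopFree : Prog → Prop
  | .skip => True
  | .assign _ _ => True
  | .put _ _ _ => True
  | .seq p q => p.LoopFree ∧ q.LoopFree
  | .cond _ p q => p.LoopFree ∧ q.LoopFree
  | .loop _ _ => False

/-- A bound for the number of steps of a program without loops. -/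
def Prog.bound : Prog → ℕ
  | .skip => 1
  | .assign _ e => e.cost + 1
  | .put _ e f => e.cost + f.cost + 1
  | .seq p q => p.bound + q.bound
  | .cond e p q => e.cost + (p.bound + q.bound) + 1
  | .loop _ _ => 0

/-- Started in the state `s`, the program `P` halts after at most `T` steps in a state with the
property `Q`. -/
def Runs (P : Prog) (s : State) (T : ℕ) (Q : State → Prop) : Prop :=
  ∃ t s', Exec P s t s' ∧ t ≤ T ∧ Q s'

lemma Runs.mono {P : Prog} {s : State} {T T' : ℕ} {Q Q' : State → Prop} (h : Runs P s T Q)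
    (hT : T ≤ T') (hQ : ∀ s, Q s → Q' s) : Runs P s T' Q' := by
  obtain ⟨t, s', h1, h2, h3⟩ := h
  exact ⟨t, s', h1, h2.trans hT, hQ s' h3⟩

lemma Runs.seq {P R : Prog} {s : State} {T U : ℕ} {Q Q' : State → Prop} (h : Runs P s T Q)
    (h' : ∀ s', Q s' → Runs R s' U Q') : Runs (.seq P R) s (T + U) Q' := by
  obtain ⟨t, s', h1, h2, h3⟩ := h
  obtain ⟨u, s'', h4, h5, h6⟩ := h' s' h3
  exact ⟨t + u, s'', .seq h1 h4, add_le_add h2 h5, h6⟩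

lemma Prog.LoopFree.runs {P : Prog} (hP : P.LoopFree) {s : State} {Q : State → Prop}
    (h : Q (P.run s)) : Runs P s P.bound Q := by
  suffices h' : ∃ t, Exec P s t (P.run s) ∧ t ≤ P.bound by
    obtain ⟨t, h1, h2⟩ := h'
    exact ⟨t, _, h1, h2, h⟩
  clear h
  induction P generalizing s with
  | skip => exact ⟨_, .skip s, le_rfl⟩
  | assign x e => exact ⟨_, .assign x e s, le_rfl⟩
  | put a e f => exact ⟨_, .put a e f s, le_rfl⟩
  | seq p q hp hq =>
    obtain ⟨t, h1, h2⟩ := hp hP.1 (s := s)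
    obtain ⟨u, h3, h4⟩ := hq hP.2 (s := p.run s)
    exact ⟨_, .seq h1 h3, add_le_add h2 h4⟩
  | cond e p q hp hq =>
    unfold Prog.run Prog.bound
    by_cases he : e.eval s = 0
    · obtain ⟨u, h3, h4⟩ := hq hP.2 (s := s)
      rw [if_pos he]
      exact ⟨_, .cond_false he h3, by omega⟩
    · obtain ⟨t, h1, h2⟩ := hp hP.1 (s := s)
      rw [if_neg he]
      exact ⟨_, .cond_true he h1, by omega⟩
  | loop e p _ => exact hP.elim

lemma Runs.loop {e : Exp} {P : Prog} {T N : ℕ} (Inv : ℕ → State → Prop)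
    (hstep : ∀ i < N, ∀ s, Inv i s → e.eval s ≠ 0 ∧ Runs P s T (Inv (i + 1)))
    (hend : ∀ s, Inv N s → e.eval s = 0) {s : State} (h0 : Inv 0 s) :
    Runs (.loop e P) s (N * (T + e.cost + 1) + (e.cost + 1)) (Inv N) := by
  suffices h : ∀ d i s, i + d = N → Inv i s →
      Runs (.loop e P) s (d * (T + e.cost + 1) + (e.cost + 1)) (Inv N) from
    h N 0 s (zero_add N) h0
  intro d
  induction d with
  | zero =>
    rintro i s rfl hs
    exact ⟨_, s, .loop_false (hend s hs), by omega, hs⟩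
  | succ d ih =>
    intro i s hi hs
    obtain ⟨he, t, s', h1, h2, h3⟩ := hstep i (by omega) s hs
    obtain ⟨u, s'', h4, h5, h6⟩ := ih (i + 1) s' (by omega) h3
    refine ⟨_, s'', .loop_true he h1 h4, ?_, h6⟩
    rw [Nat.succ_mul]
    omega

/-- For all values of the register `2` below the value of the register `x`, execute `P`. -/
def forLoop (x : ℕ) (P : Prog) : Prog :=
  .seq (.assign 2 (.lit 0))
    (.loop (.lt (.reg 2) (.reg x)) (.seq P (.assign 2 (.add (.reg 2) (.lit 1)))))

/-- The constant `10` generously covers initializing, testing and incrementing the counter; the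
factor `N + 1` accounts for the final test. -/
lemma Runs.forLoop {x : ℕ} {P : Prog} (hP : P.LoopFree) {N : ℕ} (Inv : ℕ → State → Prop)
    (hx : ∀ i s, Inv i s → s.reg x = N)
    (hstep : ∀ i < N, ∀ s, s.reg 2 = i → Inv i s →
      (P.run s).reg 2 = i ∧ Inv (i + 1) ((P.run s).setReg 2 (i + 1)))
    {s : State} (h0 : Inv 0 (s.setReg 2 0)) :
    Runs (PTS.forLoop x P) s ((N + 1) * (P.bound + 10)) (Inv N) := by
  have hfree : (Prog.seq P (.assign 2 (.add (.reg 2) (.lit 1)))).LoopFree := ⟨hP, trivial⟩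
  have h1 : Runs (.assign 2 (.lit 0)) s 2 fun s' => s'.reg 2 = 0 ∧ Inv 0 s' :=
    Prog.LoopFree.runs (P := .assign 2 (.lit 0)) trivial ⟨rfl, h0⟩
  have h2 := h1.seq fun s' hs' => Runs.loop (e := .lt (.reg 2) (.reg x)) (N := N)
    (fun i s => s.reg 2 = i ∧ Inv i s)
    (fun i hi s hs => ⟨by simp [Exp.eval, hs.1, hx i s hs.2, hi], hfree.runs (by
      obtain ⟨h3, h4⟩ := hstep i hi s hs.1 hs.2
      simp only [Prog.run, Exp.eval, h3]
      exact ⟨rfl, h4⟩)⟩)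
    (fun s hs => by simp [Exp.eval, hs.1, hx N s hs.2]) hs'
  refine h2.mono ?_ fun s hs => hs.2
  simp only [Prog.bound, Exp.cost]
  nlinarith

/-- `x` is the truth value of `p`. -/
def IsBit (x : ℕ) (p : Prop) : Prop := (p → x = 1) ∧ (¬p → x = 0)

lemma IsBit.ne_zero {x : ℕ} {p : Prop} (h : IsBit x p) : x ≠ 0 ↔ p := by
  by_cases hp : p
  · simp [hp, h.1 hp]
  · simp [hp, h.2 hp]

lemma IsBit.congr {x : ℕ} {p q : Prop} (h : IsBit x p) (hpq : p ↔ q) : IsBit x q := by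
  rwa [← hpq]

lemma IsBit.eq_ite {x : ℕ} {p : Prop} [Decidable p] (h : IsBit x p) :
    x = if p then 1 else 0 := by
  split_ifs with hp
  · exact h.1 hp
  · exact h.2 hp

lemma isBit_lt (s : State) (e f : Exp) : IsBit ((Exp.lt e f).eval s) (e.eval s < f.eval s) := by
  constructor <;> intro h <;> simp [Exp.eval, h]

lemma isBit_eq (s : State) (e f : Exp) : IsBit ((Exp.eq e f).eval s) (e.eval s = f.eval s) := by
  constructor <;> intro h <;> simp [Exp.eval, h]

/-- The conjunction of two tests. -/
def Exp.and (e f : Exp) : Exp := .lt (.lit 1) (.add e f)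

/-- The disjunction of two tests. -/
def Exp.or (e f : Exp) : Exp := .lt (.lit 0) (.add e f)

lemma IsBit.and {s : State} {e f : Exp} {p q : Prop} (he : IsBit (e.eval s) p)
    (hf : IsBit (f.eval s) q) : IsBit ((e.and f).eval s) (p ∧ q) := by
  by_cases hp : p <;> by_cases hq : q <;>
    simp [IsBit, Exp.and, Exp.eval, hp, hq, he.1, he.2, hf.1, hf.2]

lemma IsBit.or {s : State} {e f : Exp} {p q : Prop} (he : IsBit (e.eval s) p)
    (hf : IsBit (f.eval s) q) : IsBit ((e.or f).eval s) (p ∨ q) := by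
  by_cases hp : p <;> by_cases hq : q <;>
    simp [IsBit, Exp.or, Exp.eval, hp, hq, he.1, he.2, hf.1, hf.2]

end Programs

/-! ### Executing a round edge by edge -/

section Sweep

variable {n : ℕ}

/-- The edges of `M` with an index below `i`. -/
def edgesBelow (M : Finset (Sym2 (Fin n))) (i : ℕ) : Finset (Sym2 (Fin n)) :=
  ({j | edge j ∈ M ∧ j.val < i} : Finset (Fin n)).image edge

lemma edge_mem_edgesBelow (hn : 3 ≤ n) (M : Finset (Sym2 (Fin n))) (i : ℕ) (j : Fin n) :
    edge j ∈ edgesBelow M i ↔ edge j ∈ M ∧ j.val < i := by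
  rw [edgesBelow, (edge_injective hn).mem_finset_image]
  simp

lemma isMatching_edgesBelow (hn : 3 ≤ n) {M : Finset (Sym2 (Fin n))}
    (hM : IsMatching (SimpleGraph.cycleGraph n) M) (i : ℕ) :
    IsMatching (SimpleGraph.cycleGraph n) (edgesBelow M i) := by
  refine isMatching_image_edge hn fun j hj h => ?_
  simp only [Finset.mem_filter, Finset.mem_univ, true_and] at hj h
  exact hM.edge_next_notMem hn hj.1 h.1

lemma edgesBelow_zero (M : Finset (Sym2 (Fin n))) : edgesBelow M 0 = ∅ := by
  simp [edgesBelow]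

lemma edgesBelow_top (hn : 3 ≤ n) {M : Finset (Sym2 (Fin n))}
    (hM : IsMatching (SimpleGraph.cycleGraph n) M) : edgesBelow M n = M := by
  ext e
  constructor
  · intro h
    obtain ⟨j, hj, rfl⟩ := Finset.mem_image.1 h
    simp only [Finset.mem_filter, Finset.mem_univ, true_and] at hj
    exact hj.1
  · intro h
    obtain ⟨j, rfl⟩ := (mem_cycleGraph_edgeSet hn _).1 (hM.1 _ h)
    exact (edge_mem_edgesBelow hn M n j).2 ⟨h, j.isLt⟩

/-- The token on a vertex depends only on which of its two incident edges are swapped. -/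
lemma route_congr (hn : 3 ≤ n) {M N : Finset (Sym2 (Fin n))}
    (hM : IsMatching (SimpleGraph.cycleGraph n) M) (hN : IsMatching (SimpleGraph.cycleGraph n) N)
    (C : Fin n → Fin n) {u : Fin n} (h1 : edge u ∈ M ↔ edge u ∈ N)
    (h2 : edge (next u) ∈ M ↔ edge (next u) ∈ N) :
    route M C (next u) = route N C (next u) := by
  by_cases h : edge u ∈ M
  · rw [route_next hM C h, route_next hN C (h1.1 h)]
  · by_cases h' : edge (next u) ∈ M
    · rw [route_self hM C h', route_self hN C (h2.1 h')]
    · rw [route_next_of_notMem hn hM C h h',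
        route_next_of_notMem hn hN C (mt h1.2 h) (mt h2.2 h')]

/-- The configuration after the edges of `M` with an index below `i` have been swapped. -/
noncomputable def sweep (M : Finset (Sym2 (Fin n))) (C : Fin n → Fin n) (i : ℕ) : Fin n → Fin n :=
  route (edgesBelow M i) C

lemma sweep_zero (M : Finset (Sym2 (Fin n))) (C : Fin n → Fin n) : sweep M C 0 = C := by
  rw [sweep, edgesBelow_zero, route_empty]

lemma sweep_top (hn : 3 ≤ n) {M : Finset (Sym2 (Fin n))}
    (hM : IsMatching (SimpleGraph.cycleGraph n) M) (C : Fin n → Fin n) :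
    sweep M C n = route M C := by
  rw [sweep, edgesBelow_top hn hM]

lemma sweep_self (hn : 3 ≤ n) {M : Finset (Sym2 (Fin n))}
    (hM : IsMatching (SimpleGraph.cycleGraph n) M) (C : Fin n → Fin n) {i : Fin n}
    (h : ∀ u, next u = i → edge u ∉ M) : sweep M C i.val i = C i := by
  obtain ⟨u, rfl⟩ := next_surjective i
  refine route_next_of_notMem hn (isMatching_edgesBelow hn hM _) C ?_ ?_
  · exact fun h' => h u rfl ((edge_mem_edgesBelow hn _ _ _).1 h').1
  · exact fun h' => lt_irrefl _ ((edge_mem_edgesBelow hn _ _ _).1 h').2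

/-- The hypothesis matters at the closing edge, whose successor, the edge `0`, has been processed
already. -/
lemma sweep_next (hn : 3 ≤ n) {M : Finset (Sym2 (Fin n))}
    (hM : IsMatching (SimpleGraph.cycleGraph n) M) (C : Fin n → Fin n) {i : Fin n}
    (h : edge (next i) ∉ M) : sweep M C i.val (next i) = C (next i) := by
  refine route_next_of_notMem hn (isMatching_edgesBelow hn hM _) C ?_ ?_
  · exact fun h' => lt_irrefl _ ((edge_mem_edgesBelow hn _ _ _).1 h').2
  · exact fun h' => h ((edge_mem_edgesBelow hn _ _ _).1 h').1

lemma sweep_succ_of_notMem {M : Finset (Sym2 (Fin n))} (C : Fin n → Fin n)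
    {i : Fin n} (h : edge i ∉ M) : sweep M C (i.val + 1) = sweep M C i.val := by
  unfold sweep
  congr 1
  unfold edgesBelow
  congr 1
  ext j
  simp only [Finset.mem_filter, Finset.mem_univ, true_and]
  refine and_congr_right fun hj => ?_
  have : j.val ≠ i.val := fun hh => h (Fin.ext hh ▸ hj)
  omega

lemma sweep_succ_of_mem (hn : 3 ≤ n) {M : Finset (Sym2 (Fin n))}
    (hM : IsMatching (SimpleGraph.cycleGraph n) M) (C : Fin n → Fin n)
    {i : Fin n} (h : edge i ∈ M) (v : Fin n) : sweep M C (i.val + 1) v =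
      if v = next i then sweep M C i.val i else if v = i then sweep M C i.val (next i)
        else sweep M C i.val v := by
  have hM1 := isMatching_edgesBelow hn hM (i.val + 1)
  have hmem : edge i ∈ edgesBelow M (i.val + 1) :=
    (edge_mem_edgesBelow hn _ _ _).2 ⟨h, Nat.lt_succ_self _⟩
  split_ifs with h1 h2
  · rw [h1, sweep_self hn hM C fun u hu hu' => hM.edge_next_notMem hn hu' (hu ▸ h)]
    exact route_next hM1 C hmem
  · rw [h2, sweep_next hn hM C (hM.edge_next_notMem hn h)]
    exact route_self hM1 C hmem
  · obtain ⟨u, rfl⟩ := next_surjective v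
    have key : ∀ j, j ≠ i → (edge j ∈ edgesBelow M (i.val + 1) ↔ edge j ∈ edgesBelow M i.val) := by
      intro j hj
      rw [edge_mem_edgesBelow hn, edge_mem_edgesBelow hn]
      have : j.val ≠ i.val := fun hh => hj (Fin.ext hh)
      refine and_congr_right fun _ => ?_
      omega
    exact route_congr hn hM1 (isMatching_edgesBelow hn hM _) C (key u fun hu => h1 (hu ▸ rfl))
      (key _ h2)

end Sweep

/-! ### The program

Registers: `0` holds `n`, `1` the number `k` of rounds, `2` the index `i` of the current edge, `3`
the vertex `next i`, `4` the number `k * n`, `5` and `6` are temporary, `7` and `8` tell whether the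
configurations differ from the identity.
Arrays: `0` and `2` hold the configurations on the cycle and on the path, `3` and `1` the matchings
used, `4` the parities, `5` the halves, `6` the remainders modulo `n`, `7` the opposite edges. -/

section Program

/-- If the value of `mark` is `1` for the edge `i`, swap along this edge in the array `a`; in any
case record the value in the array `o`. -/
def stepProg (a o : ℕ) (mark : Exp) : Prog :=
  .seq (.assign 5 mark) (.seq (.put o (.add (.reg 4) (.reg 2)) (.reg 5))
    (.cond (.reg 5) (.seq (.assign 6 (.get a (.reg 2)))
      (.seq (.put a (.reg 2) (.get a (.reg 3))) (.put a (.reg 3) (.reg 6)))) .skip))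

/-- The test whether the edge `i` belongs to the current phase on the cycle. -/
def phaseExp : Exp :=
  .or (.and (.eq (.get 4 (.reg 0)) (.lit 0)) (.eq (.get 4 (.reg 2)) (.get 4 (.reg 1))))
    (.and (.eq (.get 4 (.reg 0)) (.lit 1))
      (.or (.and (.eq (.get 4 (.reg 1)) (.lit 1)) (.eq (.add (.reg 2) (.lit 1)) (.reg 0)))
        (.and (.eq (.get 4 (.reg 1)) (.lit 0))
          (.and (.eq (.get 4 (.reg 2)) (.get 4 (.get 5 (.reg 1))))
            (.lt (.add (.reg 2) (.lit 1)) (.reg 0))))))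

/-- The position of the vertex `v` on the path left by the edge opposite to `i`. -/
def posExp (v : Exp) : Exp :=
  .get 6 (.add v (.sub (.sub (.reg 0) (.lit 1)) (.get 7 (.reg 2))))

/-- The test whether the edge `i` is to be swapped on the cycle. -/
def cycleMark : Exp :=
  .and phaseExp (.lt (posExp (.get 0 (.reg 3))) (posExp (.get 0 (.reg 2))))

/-- The test whether the edge `i` is to be swapped on the path. -/
def pathMark : Exp :=
  .and (.eq (.get 4 (.reg 2)) (.get 4 (.reg 1)))
    (.and (.lt (.add (.reg 2) (.lit 1)) (.reg 0)) (.lt (.get 2 (.reg 3)) (.get 2 (.reg 2))))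

/-- One edge of one round. -/
def edgeProg : Prog :=
  .seq (.assign 3 (.get 6 (.add (.reg 2) (.lit 1))))
    (.seq (stepProg 0 3 cycleMark) (stepProg 2 1 pathMark))

/-- Compare the token on one vertex with its destination. -/
def compareProg : Prog :=
  .seq (.cond (.eq (.get 0 (.reg 2)) (.reg 2)) .skip (.assign 7 (.lit 1)))
    (.cond (.eq (.get 2 (.reg 2)) (.reg 2)) .skip (.assign 8 (.lit 1)))

/-- Compare the two configurations with the identity. -/
def checkProg : Prog :=
  .seq (.assign 7 (.lit 0)) (.seq (.assign 8 (.lit 0)) (forLoop 0 compareProg))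

/-- One round of both procedures. -/
def roundProg : Prog :=
  .seq (forLoop 0 edgeProg)
    (.seq (.seq (.assign 1 (.add (.reg 1) (.lit 1))) (.assign 4 (.add (.reg 4) (.reg 0))))
      checkProg)

/-- One entry of the tables of parities, halves and remainders, and of the second copy of the
configuration. -/
def tableProg : Prog :=
  .seq (.put 4 (.add (.reg 2) (.lit 1)) (.sub (.lit 1) (.get 4 (.reg 2))))
    (.seq (.put 5 (.add (.reg 2) (.lit 1)) (.add (.get 5 (.reg 2)) (.get 4 (.reg 2))))
      (.seq (.put 6 (.reg 2) (.reg 2))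
        (.seq (.put 6 (.add (.reg 0) (.reg 2)) (.reg 2)) (.put 2 (.reg 2) (.get 0 (.reg 2))))))

/-- One entry of the table of opposite edges. -/
def oppositeProg : Prog :=
  .cond (.lt (.reg 2) (.get 5 (.reg 0))) (.put 7 (.reg 2) (.add (.reg 2) (.get 5 (.reg 0))))
    (.put 7 (.reg 2) (.sub (.reg 2) (.get 5 (.reg 0))))

/-- One entry of the output of the procedure on the cycle. -/
def copyProg : Prog := .put 1 (.reg 2) (.get 3 (.reg 2))

/-- The program that computes the output of the algorithm. -/
def algProg : Prog :=
  .seq (forLoop 0 tableProg) (.seq (forLoop 0 oppositeProg) (.seq checkProg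
    (.seq (.loop (.and (.reg 7) (.reg 8)) roundProg)
      (.cond (.eq (.reg 7) (.lit 0)) (forLoop 4 copyProg) .skip))))

/-! ### Its correctness -/

variable {n : ℕ}

/-- The array `a` holds the configuration `D`. -/
def HoldsConf (a : ℕ) (D : Fin n → Fin n) (s : State) : Prop :=
  ∀ v : Fin n, s.arr a v.val = (D v).val

/-- The cells below `N` of the array `o` hold the matchings `G 0, G 1, …`. -/
def HoldsEdges (o : ℕ) (G : ℕ → Finset (Sym2 (Fin n))) (N : ℕ) (s : State) : Prop :=
  ∀ (j : ℕ) (v : Fin n), j * n + v.val < N → IsBit (s.arr o (j * n + v.val)) (edge v ∈ G j)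

/-- The tables are complete. -/
structure HasTables (n : ℕ) (s : State) : Prop where
  size : s.reg 0 = n
  parity : ∀ i ≤ n, s.arr 4 i = i % 2
  half : ∀ i ≤ n, s.arr 5 i = i / 2
  rem : ∀ i < 2 * n, s.arr 6 i = i % n
  opp : ∀ i < n, s.arr 7 i = opposite n i

lemma HasTables.congr {s s' : State} (h : HasTables n s) (h0 : s'.reg 0 = s.reg 0)
    (h4 : s'.arr 4 = s.arr 4) (h5 : s'.arr 5 = s.arr 5) (h6 : s'.arr 6 = s.arr 6)
    (h7 : s'.arr 7 = s.arr 7) : HasTables n s' := by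
  refine ⟨?_, ?_, ?_, ?_, ?_⟩
  · rw [h0]; exact h.size
  · rw [h4]; exact h.parity
  · rw [h5]; exact h.half
  · rw [h6]; exact h.rem
  · rw [h7]; exact h.opp

lemma HoldsConf.congr {a : ℕ} {D : Fin n → Fin n} {s s' : State} (h : HoldsConf a D s)
    (ha : s'.arr a = s.arr a) : HoldsConf a D s' := by
  unfold HoldsConf
  rw [ha]
  exact h

lemma HoldsEdges.congr {o : ℕ} {G : ℕ → Finset (Sym2 (Fin n))} {N : ℕ} {s s' : State}
    (h : HoldsEdges o G N s) (ho : s'.arr o = s.arr o) : HoldsEdges o G N s' := by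
  unfold HoldsEdges
  rw [ho]
  exact h

/-! ### The effect of one step on registers and arrays -/

lemma setReg_reg (s : State) (x v y : ℕ) : (s.setReg x v).reg y = if y = x then v else s.reg y :=
  rfl

lemma setReg_arr (s : State) (x v : ℕ) : (s.setReg x v).arr = s.arr := rfl

lemma setArr_reg (s : State) (a i v : ℕ) : (s.setArr a i v).reg = s.reg := rfl

lemma setArr_arr_self (s : State) (a i v j : ℕ) :
    (s.setArr a i v).arr a j = if j = i then v else s.arr a j := by
  simp [State.setArr]

lemma setArr_arr_of_ne (s : State) {a b : ℕ} (i v : ℕ) (h : b ≠ a) :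
    (s.setArr a i v).arr b = s.arr b := by
  funext j
  simp [State.setArr, h]

lemma stepProg_run {a o : ℕ} (hao : a ≠ o) (mark : Exp) (s : State) :
    (stepProg a o mark).run s =
      if mark.eval s = 0 then (s.setReg 5 (mark.eval s)).setArr o (s.reg 4 + s.reg 2) (mark.eval s)
      else ((((s.setReg 5 (mark.eval s)).setArr o (s.reg 4 + s.reg 2) (mark.eval s)).setReg 6
        (s.arr a (s.reg 2))).setArr a (s.reg 2) (s.arr a (s.reg 3))).setArr a (s.reg 3)
          (s.arr a (s.reg 2)) := by
  simp only [stepProg, Prog.run, Exp.eval, setReg_reg, setArr_reg, setReg_arr,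
    setArr_arr_of_ne _ _ _ hao]
  rfl

lemma stepProg_reg {a o : ℕ} (hao : a ≠ o) (mark : Exp) (s : State) {x : ℕ} (h5 : x ≠ 5)
    (h6 : x ≠ 6) : ((stepProg a o mark).run s).reg x = s.reg x := by
  rw [stepProg_run hao]
  split_ifs <;> simp [setReg_reg, setArr_reg, h5, h6]

lemma stepProg_arr {a o : ℕ} (hao : a ≠ o) (mark : Exp) (s : State) {b : ℕ} (ha : b ≠ a)
    (ho : b ≠ o) : ((stepProg a o mark).run s).arr b = s.arr b := by
  rw [stepProg_run hao]
  split_ifs <;> simp [setReg_arr, setArr_arr_of_ne, ha, ho]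

lemma stepProg_arr_output {a o : ℕ} (hao : a ≠ o) (mark : Exp) (s : State) (j : ℕ) :
    ((stepProg a o mark).run s).arr o j =
      if j = s.reg 4 + s.reg 2 then mark.eval s else s.arr o j := by
  rw [stepProg_run hao]
  by_cases h : mark.eval s = 0 <;>
    simp [h, setReg_arr, setArr_arr_of_ne, setArr_arr_self, hao.symm]

lemma stepProg_arr_conf {a o : ℕ} (hao : a ≠ o) (mark : Exp) (s : State) (j : ℕ) :
    ((stepProg a o mark).run s).arr a j =
      if mark.eval s = 0 then s.arr a j
      else if j = s.reg 3 then s.arr a (s.reg 2) else if j = s.reg 2 then s.arr a (s.reg 3)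
        else s.arr a j := by
  rw [stepProg_run hao]
  by_cases h : mark.eval s = 0 <;>
    simp [h, setReg_arr, setArr_arr_of_ne, setArr_arr_self, hao]

lemma stepProg_spec (hn : 3 ≤ n) {a o : ℕ} (hao : a ≠ o) {mark : Exp} {s : State} {k : ℕ}
    {i : Fin n} (h2 : s.reg 2 = i.val) (h3 : s.reg 3 = (next i).val) (h4 : s.reg 4 = k * n)
    {G : ℕ → Finset (Sym2 (Fin n))} (hG : IsMatching (SimpleGraph.cycleGraph n) (G k))
    {C : Fin n → Fin n}
    (hmark : IsBit (mark.eval s) (edge i ∈ G k)) (hC : HoldsConf a (sweep (G k) C i.val) s)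
    (hE : HoldsEdges o G (k * n + i.val) s) :
    HoldsConf a (sweep (G k) C (i.val + 1)) ((stepProg a o mark).run s) ∧
      HoldsEdges o G (k * n + (i.val + 1)) ((stepProg a o mark).run s) := by
  constructor
  · intro v
    rw [stepProg_arr_conf hao, h2, h3, hC, hC, hC]
    by_cases h : edge i ∈ G k
    · rw [if_neg (hmark.ne_zero.2 h), sweep_succ_of_mem hn hG C h]
      simp only [Fin.val_inj]
      split_ifs <;> rfl
    · rw [if_pos (hmark.2 h), sweep_succ_of_notMem C h]
  · intro j v hjv
    rw [stepProg_arr_output hao, h2, h4]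
    split_ifs with h
    · have hv := v.isLt
      have hi := i.isLt
      -- Row and column of a cell are recovered from its address by division by `n`.
      have h5 : j = k := by
        have h6 : (j * n + v.val) / n = j := by
          rw [mul_comm, Nat.mul_add_div (by omega), Nat.div_eq_of_lt hv, add_zero]
        have h7 : (k * n + i.val) / n = k := by
          rw [mul_comm, Nat.mul_add_div (by omega), Nat.div_eq_of_lt hi, add_zero]
        rw [← h6, h, h7]
      subst h5
      have h6 : v = i := Fin.ext (by omega)
      rwa [h6]
    · exact hE j v (by omega)

lemma eval_posExp {s : State} (hs : HasTables n s) {i : Fin n} (h2 : s.reg 2 = i.val) (v : Exp)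
    (hv : v.eval s < n) : (posExp v).eval s = pathPos n (opposite n i.val) (v.eval s) := by
  simp only [posExp, Exp.eval, h2, hs.size]
  rw [hs.opp _ i.isLt, hs.rem _ (by omega)]
  rfl

/-- The residue of `k` modulo `4` is read off from the parities of `k` and `k / 2`. -/
lemma isBit_phaseExp {s : State} (hs : HasTables n s) {i : Fin n} {k : ℕ} (hk : k ≤ n)
    (h1 : s.reg 1 = k) (h2 : s.reg 2 = i.val) :
    IsBit (phaseExp.eval s) (i ∈ cyclePhase n k) := by
  have hi := i.isLt
  have h := ((isBit_eq s (.get 4 (.reg 0)) (.lit 0)).and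
    (isBit_eq s (.get 4 (.reg 2)) (.get 4 (.reg 1)))).or
    ((isBit_eq s (.get 4 (.reg 0)) (.lit 1)).and
      (((isBit_eq s (.get 4 (.reg 1)) (.lit 1)).and
        (isBit_eq s (.add (.reg 2) (.lit 1)) (.reg 0))).or
        ((isBit_eq s (.get 4 (.reg 1)) (.lit 0)).and
          ((isBit_eq s (.get 4 (.reg 2)) (.get 4 (.get 5 (.reg 1)))).and
            (isBit_lt s (.add (.reg 2) (.lit 1)) (.reg 0))))))
  refine IsBit.congr h ?_
  simp only [Exp.eval, hs.size, h1, h2]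
  rw [hs.parity _ le_rfl, hs.parity _ hk, hs.parity _ hi.le, hs.half _ hk,
    hs.parity (k / 2) (by omega)]
  unfold cyclePhase
  split_ifs <;>
    simp only [edgesA, edgesB, edgeClosing, Finset.mem_filter, Finset.mem_univ, true_and] <;>
    omega

/-- The test reads a partially swapped configuration. For an edge of the phase, neither neighbouring
edge is in the phase, so its two tokens are still those from the beginning of the round. -/
lemma isBit_cycleMark (hn : 3 ≤ n) {s : State} (hs : HasTables n s) {i : Fin n} {k : ℕ}
    (hk : k ≤ n) (h1 : s.reg 1 = k) (h2 : s.reg 2 = i.val) (h3 : s.reg 3 = (next i).val)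
    {C : Fin n → Fin n} (hC : HoldsConf 0 (sweep (cycleRound k C) C i.val) s) :
    IsBit (cycleMark.eval s) (edge i ∈ cycleRound k C) := by
  refine IsBit.congr ((isBit_phaseExp hs hk h1 h2).and (isBit_lt s (posExp (.get 0 (.reg 3)))
    (posExp (.get 0 (.reg 2))))) ?_
  rw [edge_mem_cycleRound hn]
  refine and_congr_right fun hi => ?_
  have h4 : (Exp.get 0 (.reg 2)).eval s = (C i).val := by
    simp only [Exp.eval, h2]
    rw [hC, sweep_self hn (isMatching_cycleRound hn k C)]
    rintro u rfl hu
    exact next_notMem_cyclePhase hn ((edge_mem_cycleRound hn _ _ _).1 hu).1 hi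
  have h5 : (Exp.get 0 (.reg 3)).eval s = (C (next i)).val := by
    simp only [Exp.eval, h3]
    rw [hC, sweep_next hn (isMatching_cycleRound hn k C)]
    exact fun hu => next_notMem_cyclePhase hn hi ((edge_mem_cycleRound hn _ _ _).1 hu).1
  rw [eval_posExp hs h2 (.get 0 (.reg 2)) (by rw [h4]; exact (C i).isLt),
    eval_posExp hs h2 (.get 0 (.reg 3)) (by rw [h5]; exact (C (next i)).isLt), h4, h5]
  rfl

lemma isBit_pathMark (hn : 3 ≤ n) {s : State} (hs : HasTables n s) {i : Fin n} {k : ℕ}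
    (hk : k ≤ n) (h1 : s.reg 1 = k) (h2 : s.reg 2 = i.val) (h3 : s.reg 3 = (next i).val)
    {C : Fin n → Fin n} (hC : HoldsConf 2 (sweep (pathRound k C) C i.val) s) :
    IsBit (pathMark.eval s) (edge i ∈ pathRound k C) := by
  refine IsBit.congr ((isBit_eq s (.get 4 (.reg 2)) (.get 4 (.reg 1))).and
    ((isBit_lt s (.add (.reg 2) (.lit 1)) (.reg 0)).and
      (isBit_lt s (.get 2 (.reg 3)) (.get 2 (.reg 2))))) ?_
  rw [edge_mem_pathRound hn]
  simp only [Exp.eval, h1, h2, h3, hs.size]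
  rw [hs.parity _ hk, hs.parity _ i.isLt.le]
  refine and_congr_right fun hp => and_congr_right fun hlt => ?_
  have h4 := next_val i
  rw [if_neg hlt.ne] at h4
  rw [hC, hC, sweep_self hn (isMatching_pathRound hn k C),
    sweep_next hn (isMatching_pathRound hn k C),
    Fin.lt_def]
  · intro hu
    have := ((edge_mem_pathRound hn _ _ _).1 hu).1
    omega
  · rintro u rfl hu
    have h5 := (edge_mem_pathRound hn _ _ _).1 hu
    have h6 := next_val u
    rw [if_neg h5.2.1.ne] at h6
    omega

/-! ### Simulating a round of both procedures -/

/-- The state after `k` rounds and the first `i` edges of the next round, for the configuration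
`C` at the beginning. -/
structure Simulates (C : Fin n → Fin n) (k i : ℕ) (s : State) : Prop where
  tables : HasTables n s
  count : s.reg 1 = k
  offset : s.reg 4 = k * n
  cycleConf : HoldsConf 0
    (sweep (cycleRound k (traj cycleRound C k)) (traj cycleRound C k) i) s
  pathConf : HoldsConf 2 (sweep (pathRound k (traj pathRound C k)) (traj pathRound C k) i) s
  cycleEdges : HoldsEdges 3 (fun j => cycleRound j (traj cycleRound C j)) (k * n + i) s
  pathEdges : HoldsEdges 1 (fun j => pathRound j (traj pathRound C j)) (k * n + i) s

lemma Simulates.congr {C : Fin n → Fin n} {k i : ℕ} {s s' : State} (h : Simulates C k i s)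
    (harr : s'.arr = s.arr) (h0 : s'.reg 0 = s.reg 0) (h1 : s'.reg 1 = s.reg 1)
    (h4 : s'.reg 4 = s.reg 4) : Simulates C k i s' where
  tables := h.tables.congr h0 (by rw [harr]) (by rw [harr]) (by rw [harr]) (by rw [harr])
  count := h1.trans h.count
  offset := h4.trans h.offset
  cycleConf := h.cycleConf.congr (by rw [harr])
  pathConf := h.pathConf.congr (by rw [harr])
  cycleEdges := h.cycleEdges.congr (by rw [harr])
  pathEdges := h.pathEdges.congr (by rw [harr])

lemma Simulates.setReg_two {C : Fin n → Fin n} {k i : ℕ} {s : State} (h : Simulates C k i s)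
    (v : ℕ) : Simulates C k i (s.setReg 2 v) :=
  h.congr rfl rfl rfl rfl

/-- The two procedures write to disjoint pairs of arrays, so their steps do not interfere. -/
lemma Simulates.edgeStep (hn : 3 ≤ n) {C : Fin n → Fin n} {k : ℕ} (hk : k ≤ n) {i : Fin n}
    {s : State} (h2 : s.reg 2 = i.val) (h : Simulates C k i.val s) :
    Simulates C k (i.val + 1) (edgeProg.run s) := by
  obtain ⟨s₁, hs₁⟩ : ∃ s₁, s₁ = (Prog.assign 3 (.get 6 (.add (.reg 2) (.lit 1)))).run s := ⟨_, rfl⟩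
  obtain ⟨s₂, hs₂⟩ : ∃ s₂, s₂ = (stepProg 0 3 cycleMark).run s₁ := ⟨_, rfl⟩
  have hrun : edgeProg.run s = (stepProg 2 1 pathMark).run s₂ := by rw [hs₂, hs₁]; rfl
  have h₁ : Simulates C k i.val s₁ := by
    rw [hs₁]
    exact h.congr rfl rfl rfl rfl
  have h₁2 : s₁.reg 2 = i.val := by rw [hs₁]; exact h2
  have h₁3 : s₁.reg 3 = (next i).val := by
    have := i.isLt
    rw [hs₁]
    simp only [Prog.run, Exp.eval, setReg_reg, if_true, h2]
    rw [h.tables.rem _ (by omega)]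
    rfl
  have hc := stepProg_spec hn (a := 0) (o := 3) (by omega)
    (G := fun j => cycleRound j (traj cycleRound C j)) (C := traj cycleRound C k) h₁2 h₁3 h₁.offset
    (isMatching_cycleRound hn k _) (isBit_cycleMark hn h₁.tables hk h₁.count h₁2 h₁3 h₁.cycleConf)
    h₁.cycleConf h₁.cycleEdges
  rw [← hs₂] at hc
  have hreg : ∀ x, x ≠ 5 → x ≠ 6 → s₂.reg x = s₁.reg x := fun x h5 h6 => by
    rw [hs₂, stepProg_reg (by omega) _ _ h5 h6]
  have harr : ∀ b, b ≠ 0 → b ≠ 3 → s₂.arr b = s₁.arr b := fun b h5 h6 => by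
    rw [hs₂, stepProg_arr (by omega) _ _ h5 h6]
  have ht : HasTables n s₂ := h₁.tables.congr (hreg 0 (by omega) (by omega))
    (harr 4 (by omega) (by omega)) (harr 5 (by omega) (by omega)) (harr 6 (by omega) (by omega))
    (harr 7 (by omega) (by omega))
  have h₂1 : s₂.reg 1 = k := (hreg 1 (by omega) (by omega)).trans h₁.count
  have h₂2 : s₂.reg 2 = i.val := (hreg 2 (by omega) (by omega)).trans h₁2
  have h₂3 : s₂.reg 3 = (next i).val := (hreg 3 (by omega) (by omega)).trans h₁3
  have h₂4 : s₂.reg 4 = k * n := (hreg 4 (by omega) (by omega)).trans h₁.offset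
  have h₂c := h₁.pathConf.congr (harr 2 (by omega) (by omega))
  have hp := stepProg_spec hn (a := 2) (o := 1) (by omega)
    (G := fun j => pathRound j (traj pathRound C j)) (C := traj pathRound C k) h₂2 h₂3 h₂4
    (isMatching_pathRound hn k _) (isBit_pathMark hn ht hk h₂1 h₂2 h₂3 h₂c)
    h₂c (h₁.pathEdges.congr (harr 1 (by omega) (by omega)))
  have hreg' : ∀ x, x ≠ 5 → x ≠ 6 → (edgeProg.run s).reg x = s₂.reg x := fun x h5 h6 => by
    rw [hrun, stepProg_reg (by omega) _ _ h5 h6]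
  have harr' : ∀ b, b ≠ 2 → b ≠ 1 → (edgeProg.run s).arr b = s₂.arr b := fun b h5 h6 => by
    rw [hrun, stepProg_arr (by omega) _ _ h5 h6]
  rw [← hrun] at hp
  exact ⟨ht.congr (hreg' 0 (by omega) (by omega))
      (harr' 4 (by omega) (by omega)) (harr' 5 (by omega) (by omega))
      (harr' 6 (by omega) (by omega)) (harr' 7 (by omega) (by omega)),
    (hreg' 1 (by omega) (by omega)).trans h₂1, (hreg' 4 (by omega) (by omega)).trans h₂4,
    hc.1.congr (harr' 0 (by omega) (by omega)), hp.1,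
    hc.2.congr (harr' 3 (by omega) (by omega)), hp.2⟩

lemma edgeProg_reg_two (s : State) : (edgeProg.run s).reg 2 = s.reg 2 := by
  simp only [edgeProg, Prog.run]
  rw [stepProg_reg (by omega) _ _ (by omega) (by omega),
    stepProg_reg (by omega) _ _ (by omega) (by omega)]
  rfl

lemma stepProg_loopFree (a o : ℕ) (mark : Exp) : (stepProg a o mark).LoopFree := by
  simp [stepProg, Prog.LoopFree]

lemma runs_edges (hn : 3 ≤ n) {C : Fin n → Fin n} {k : ℕ} (hk : k ≤ n) {s : State}
    (h : Simulates C k 0 s) :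
    Runs (forLoop 0 edgeProg) s ((n + 1) * (edgeProg.bound + 10)) (Simulates C k n) := by
  refine Runs.forLoop (P := edgeProg) (N := n)
    ⟨trivial, stepProg_loopFree _ _ _, stepProg_loopFree _ _ _⟩
    (Simulates C k) (fun i s hs => hs.tables.size) (fun i hi s h2 hs => ⟨?_, ?_⟩)
    (h.setReg_two _)
  · rw [edgeProg_reg_two, h2]
  · exact (hs.edgeStep hn hk (i := ⟨i, hi⟩) h2).setReg_two _

/-- The state between two rounds. -/
structure Ready (C : Fin n → Fin n) (k : ℕ) (s : State) : Prop where
  sim : Simulates C k 0 s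
  cycleFlag : IsBit (s.reg 7) (traj cycleRound C k ≠ id)
  pathFlag : IsBit (s.reg 8) (traj pathRound C k ≠ id)

lemma ne_id_iff (D : Fin n → Fin n) : (∃ v : Fin n, v.val < n ∧ (D v).val ≠ v.val) ↔ D ≠ id := by
  rw [Function.ne_iff]
  refine exists_congr fun v => ?_
  simp [Fin.ext_iff]

lemma compareProg_run (s : State) (x : ℕ) : (compareProg.run s).reg x =
    if x = 8 ∧ s.arr 2 (s.reg 2) ≠ s.reg 2 ∨ x = 7 ∧ s.arr 0 (s.reg 2) ≠ s.reg 2 then 1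
      else s.reg x := by
  by_cases h0 : s.arr 0 (s.reg 2) = s.reg 2 <;> by_cases h2 : s.arr 2 (s.reg 2) = s.reg 2 <;>
    simp [compareProg, Prog.run, Exp.eval, h0, h2, setReg_reg, setReg_arr]
  split_ifs <;> simp_all

lemma compareProg_arr (s : State) : (compareProg.run s).arr = s.arr := by
  simp only [compareProg, Prog.run]
  split_ifs <;> rfl

lemma isBit_exists_step {D : Fin n → Fin n} {a i : ℕ} (hi : i < n) {s : State}
    (hC : HoldsConf a D s) {x x' : ℕ}
    (hx : IsBit x (∃ v : Fin n, v.val < i ∧ (D v).val ≠ v.val))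
    (hx' : x' = if s.arr a i ≠ i then 1 else x) :
    IsBit x' (∃ v : Fin n, v.val < i + 1 ∧ (D v).val ≠ v.val) := by
  have h1 := hC ⟨i, hi⟩
  simp only at h1
  rw [hx', h1]
  split_ifs with h
  · exact ⟨fun _ => rfl, fun h' => absurd ⟨⟨i, hi⟩, Nat.lt_succ_self _, h⟩ h'⟩
  · refine hx.congr ⟨fun ⟨v, h2, h3⟩ => ⟨v, by omega, h3⟩, fun ⟨v, h2, h3⟩ => ⟨v, ?_, h3⟩⟩
    obtain h4 | h4 := (Nat.lt_succ_iff.1 h2).lt_or_eq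
    · exact h4
    · obtain rfl : v = ⟨i, hi⟩ := Fin.ext h4
      exact absurd h3 h

lemma runs_check {C : Fin n → Fin n} {k : ℕ} {s : State} (h : Simulates C k 0 s) :
    Runs checkProg s (4 + (n + 1) * (compareProg.bound + 10)) (Ready C k) := by
  have h1 : Runs (.assign 7 (.lit 0)) s 2 fun s => Simulates C k 0 s ∧ s.reg 7 = 0 :=
    Prog.LoopFree.runs (P := .assign 7 (.lit 0)) trivial ⟨h.congr rfl rfl rfl rfl, rfl⟩
  have h2 : ∀ s, (Simulates C k 0 s ∧ s.reg 7 = 0) → Runs (.assign 8 (.lit 0)) s 2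
      fun s => Simulates C k 0 s ∧ s.reg 7 = 0 ∧ s.reg 8 = 0 := fun s hs =>
    Prog.LoopFree.runs (P := .assign 8 (.lit 0)) trivial
      ⟨hs.1.congr rfl rfl rfl rfl, hs.2, rfl⟩
  have h3 : ∀ s, (Simulates C k 0 s ∧ s.reg 7 = 0 ∧ s.reg 8 = 0) →
      Runs (forLoop 0 compareProg) s ((n + 1) * (compareProg.bound + 10)) fun s =>
        Simulates C k 0 s ∧
        IsBit (s.reg 7) (∃ v : Fin n, v.val < n ∧ (traj cycleRound C k v).val ≠ v.val) ∧
        IsBit (s.reg 8) (∃ v : Fin n, v.val < n ∧ (traj pathRound C k v).val ≠ v.val) := by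
    intro s hs
    refine Runs.forLoop (N := n) (by simp [compareProg, Prog.LoopFree]) (fun i s =>
        Simulates C k 0 s ∧
        IsBit (s.reg 7) (∃ v : Fin n, v.val < i ∧ (traj cycleRound C k v).val ≠ v.val) ∧
        IsBit (s.reg 8) (∃ v : Fin n, v.val < i ∧ (traj pathRound C k v).val ≠ v.val))
      (fun i s hs => hs.1.tables.size) (fun i hi s h2 hs => ⟨?_, ?_, ?_, ?_⟩) ⟨?_, ?_, ?_⟩
    · simp [compareProg_run, h2]
    · refine hs.1.congr (compareProg_arr s) ?_ ?_ ?_ <;> simp [setReg_reg, compareProg_run]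
    · refine isBit_exists_step hi (sweep_zero _ _ ▸ hs.1.cycleConf) hs.2.1 ?_
      simp [setReg_reg, compareProg_run, h2]
    · refine isBit_exists_step hi (sweep_zero _ _ ▸ hs.1.pathConf) hs.2.2 ?_
      simp [setReg_reg, compareProg_run, h2]
    · exact hs.1.congr rfl rfl rfl rfl
    · simp [IsBit, setReg_reg, hs.2.1]
    · simp [IsBit, setReg_reg, hs.2.2]
  refine (h1.seq fun s hs => (h2 s hs).seq h3).mono (by omega) fun s hs => ⟨hs.1, ?_, ?_⟩
  · exact hs.2.1.congr (ne_id_iff _)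
  · exact hs.2.2.congr (ne_id_iff _)

/-- A bound for the number of steps of one round, divided by `n + 1`. -/
def roundCost : ℕ := edgeProg.bound + compareProg.bound + 40

lemma runs_round (hn : 3 ≤ n) {C : Fin n → Fin n} {k : ℕ} (hk : k ≤ n) {s : State}
    (h : Ready C k s) : Runs roundProg s ((n + 1) * roundCost) (Ready C (k + 1)) := by
  have h2 : ∀ s, Simulates C k n s → Runs
      (.seq (.assign 1 (.add (.reg 1) (.lit 1))) (.assign 4 (.add (.reg 4) (.reg 0)))) s 8
      (Simulates C (k + 1) 0) := by
    intro s hs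
    refine Prog.LoopFree.runs
      (P := .seq (.assign 1 (.add (.reg 1) (.lit 1))) (.assign 4 (.add (.reg 4) (.reg 0))))
      ⟨trivial, trivial⟩ ?_
    have he : k * n + n = (k + 1) * n + 0 := by ring
    refine ⟨hs.tables.congr rfl rfl rfl rfl rfl, ?_, ?_, ?_, ?_, ?_, ?_⟩
    · simp [Prog.run, Exp.eval, setReg_reg, hs.count]
    · simp [Prog.run, Exp.eval, setReg_reg, hs.offset, hs.tables.size, Nat.succ_mul]
    · rw [sweep_zero]
      have := hs.cycleConf
      rw [sweep_top hn (isMatching_cycleRound hn _ _)] at this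
      exact this
    · rw [sweep_zero]
      have := hs.pathConf
      rw [sweep_top hn (isMatching_pathRound hn _ _)] at this
      exact this
    · rw [← he]
      exact hs.cycleEdges.congr rfl
    · rw [← he]
      exact hs.pathEdges.congr rfl
  refine ((runs_edges hn hk h.sim).seq fun s hs => (h2 s hs).seq fun s hs => runs_check hs).mono
    ?_ fun s hs => hs
  unfold roundCost
  nlinarith

/-! ### Tables, output and total cost -/

/-- The state while the tables are being built. -/
structure BuildsTables (C : Fin n → Fin n) (i : ℕ) (s : State) : Prop where
  size : s.reg 0 = n
  count : s.reg 1 = 0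
  offset : s.reg 4 = 0
  conf : HoldsConf 0 C s
  copy : ∀ v : Fin n, v.val < i → s.arr 2 v.val = (C v).val
  parity : ∀ j ≤ i, s.arr 4 j = j % 2
  half : ∀ j ≤ i, s.arr 5 j = j / 2
  rem : ∀ j < i, s.arr 6 j = j ∧ s.arr 6 (n + j) = j

lemma BuildsTables.tableStep {C : Fin n → Fin n} {i : ℕ} (hi : i < n) {s : State}
    (h2 : s.reg 2 = i) (h : BuildsTables C i s) :
    BuildsTables C (i + 1) ((tableProg.run s).setReg 2 (i + 1)) := by
  have hreg : (tableProg.run s).reg = s.reg := rfl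
  have h0 : (tableProg.run s).arr 0 = s.arr 0 := by
    simp [tableProg, Prog.run, setArr_arr_of_ne]
  have ha2 : ∀ j, (tableProg.run s).arr 2 j = if j = i then s.arr 0 i else s.arr 2 j := by
    simp [tableProg, Prog.run, setArr_arr_of_ne, setArr_arr_self, Exp.eval, setArr_reg, h2]
  have ha4 : ∀ j, (tableProg.run s).arr 4 j = if j = i + 1 then 1 - s.arr 4 i else s.arr 4 j := by
    simp [tableProg, Prog.run, setArr_arr_of_ne, setArr_arr_self, Exp.eval, h2]
  have ha5 : ∀ j, (tableProg.run s).arr 5 j =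
      if j = i + 1 then s.arr 5 i + s.arr 4 i else s.arr 5 j := by
    simp [tableProg, Prog.run, setArr_arr_of_ne, setArr_arr_self, Exp.eval, setArr_reg, h2]
  have ha6 : ∀ j, (tableProg.run s).arr 6 j =
      if j = n + i then i else if j = i then i else s.arr 6 j := by
    simp [tableProg, Prog.run, setArr_arr_of_ne, setArr_arr_self, Exp.eval, setArr_reg, h2,
      h.size]
  refine ⟨?_, ?_, ?_, ?_, ?_, ?_, ?_, ?_⟩
  · simp [setReg_reg, hreg, h.size]
  · simp [setReg_reg, hreg, h.count]
  · simp [setReg_reg, hreg, h.offset]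
  · exact h.conf.congr h0
  · intro v hv
    rw [setReg_arr, ha2]
    split_ifs with hvi
    · rw [← hvi]
      exact h.conf v
    · exact h.copy v (by omega)
  · intro j hj
    rw [setReg_arr, ha4]
    split_ifs with hji
    · rw [h.parity i le_rfl]
      omega
    · exact h.parity j (by omega)
  · intro j hj
    rw [setReg_arr, ha5]
    split_ifs with hji
    · rw [h.parity i le_rfl, h.half i le_rfl]
      omega
    · exact h.half j (by omega)
  · intro j hj
    rw [setReg_arr, ha6, ha6]
    by_cases hji : j = i
    · simp [hji]
    · have := h.rem j (by omega)
      rw [if_neg (by omega), if_neg hji, if_neg (by omega), if_neg (by omega)]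
      exact this

lemma runs_tables {C : Fin n → Fin n} :
    Runs (forLoop 0 tableProg) (input C) ((n + 1) * (tableProg.bound + 10))
      (BuildsTables C n) := by
  refine Runs.forLoop (P := tableProg) (N := n) (by simp [tableProg, Prog.LoopFree]) (BuildsTables C)
    (fun i s hs => hs.size) (fun i hi s h2 hs => ⟨h2, hs.tableStep hi h2⟩) ?_
  refine ⟨rfl, rfl, rfl, ?_, ?_, ?_, ?_, ?_⟩
  · intro v
    simp [setReg_arr, input]
  · intro v hv
    omega
  · intro j hj
    obtain rfl : j = 0 := by omega
    rfl
  · intro j hj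
    obtain rfl : j = 0 := by omega
    rfl
  · intro j hj
    omega

lemma runs_opposite {C : Fin n → Fin n} {s : State} (hs : BuildsTables C n s) :
    Runs (forLoop 0 oppositeProg) s ((n + 1) * (oppositeProg.bound + 10))
      (Simulates C 0 0) := by
  have hrun : ∀ s : State, oppositeProg.run s = s.setArr 7 (s.reg 2)
      (if s.reg 2 < s.arr 5 (s.reg 0) then s.reg 2 + s.arr 5 (s.reg 0)
        else s.reg 2 - s.arr 5 (s.reg 0)) := by
    intro s
    by_cases h : s.reg 2 < s.arr 5 (s.reg 0) <;> simp [oppositeProg, Prog.run, Exp.eval, h]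
  have h := Runs.forLoop (P := oppositeProg) (x := 0) (N := n) (s := s)
    (by simp [oppositeProg, Prog.LoopFree])
    (fun i s => BuildsTables C n s ∧ ∀ j < i, s.arr 7 j = opposite n j)
    (fun i s hs => hs.1.size) (fun i hi s h2 hs => ⟨?_, ?_, ?_⟩) ⟨?_, ?_⟩
  · refine h.mono le_rfl fun s hs => ⟨⟨hs.1.size, hs.1.parity, hs.1.half, ?_, hs.2⟩,
      hs.1.count, ?_, ?_, ?_, ?_, ?_⟩
    · intro i hi
      by_cases hin : i < n
      · rw [(hs.1.rem i hin).1, Nat.mod_eq_of_lt hin]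
      · have h1 := (hs.1.rem (i - n) (by omega)).2
        rw [show n + (i - n) = i by omega] at h1
        rw [h1, Nat.mod_eq_sub_mod (by omega), Nat.mod_eq_of_lt (by omega)]
    · rw [hs.1.offset, zero_mul]
    · rw [sweep_zero]
      exact hs.1.conf
    · rw [sweep_zero]
      exact fun v => hs.1.copy v v.isLt
    · intro j v hjv
      simp at hjv
    · intro j v hjv
      simp at hjv
  · rw [hrun, setArr_reg, h2]
  · rw [hrun]
    have ha : ∀ b, b ≠ 7 → ∀ x y z : ℕ, ((s.setArr 7 x y).setReg 2 z).arr b = s.arr b :=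
      fun b hb x y z => by rw [setReg_arr, setArr_arr_of_ne _ _ _ hb]
    refine ⟨hs.1.size, hs.1.count, hs.1.offset, hs.1.conf.congr (ha 0 (by omega) _ _ _),
      ?_, ?_, ?_, ?_⟩
    · rw [ha 2 (by omega)]
      exact hs.1.copy
    · rw [ha 4 (by omega)]
      exact hs.1.parity
    · rw [ha 5 (by omega)]
      exact hs.1.half
    · rw [ha 6 (by omega)]
      exact hs.1.rem
  · intro j hj
    rw [hrun, setReg_arr, setArr_arr_self, h2, hs.1.size, hs.1.half n le_rfl]
    split_ifs with hji
    · subst hji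
      simp [opposite, *]
    · subst hji
      simp [opposite, *]
    · exact hs.2 j (by omega)
  · exact ⟨hs.size, hs.count, hs.offset, hs.conf, hs.copy, hs.parity, hs.half, hs.rem⟩
  · intro j hj
    omega

/-- The output array contains the matchings of the path procedure by default; if the cycle procedure
wins, they are overwritten. -/
lemma runs_copy {C : Fin n → Fin n} {k : ℕ} {s : State} (hs : Simulates C k 0 s) :
    Runs (forLoop 4 copyProg) s ((k * n + 1) * (copyProg.bound + 10))
      fun s => s.reg 1 = k ∧ HoldsEdges 1 (fun j => cycleRound j (traj cycleRound C j)) (k * n) s := by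
  have hrun : ∀ s : State, copyProg.run s = s.setArr 1 (s.reg 2) (s.arr 3 (s.reg 2)) :=
    fun s => rfl
  have h := Runs.forLoop (P := copyProg) (x := 4) (N := k * n) (s := s) trivial
    (fun i s => s.reg 1 = k ∧ s.reg 4 = k * n ∧
      HoldsEdges 3 (fun j => cycleRound j (traj cycleRound C j)) (k * n) s ∧
      ∀ j < i, s.arr 1 j = s.arr 3 j)
    (fun i s hs => hs.2.1) (fun i hi s h2 hs => ⟨h2, hs.1, hs.2.1, ?_, fun j hj => ?_⟩)
    ⟨hs.count, hs.offset, hs.cycleEdges.congr rfl, by simp⟩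
  · refine h.mono le_rfl fun s hs => ⟨hs.1, fun j v hjv => ?_⟩
    rw [hs.2.2.2 _ hjv]
    exact hs.2.2.1 j v hjv
  · exact hs.2.2.1.congr (by rw [hrun, setReg_arr, setArr_arr_of_ne _ _ _ (by omega)])
  · rw [hrun, setReg_arr, setArr_arr_self, setArr_arr_of_ne _ _ _ (by omega), h2]
    split_ifs with hji
    · rw [hji]
    · exact hs.2.2.2 j (by omega)

lemma holdsOutput_rounds {F : ℕ → (Fin n → Fin n) → Finset (Sym2 (Fin n))} {C : Fin n → Fin n}
    {k : ℕ} {s : State} (h1 : s.reg 1 = k)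
    (h : HoldsEdges 1 (fun j => F j (traj F C j)) (k * n) s) :
    HoldsOutput s (rounds F C k) := by
  refine ⟨by rw [h1, length_rounds], fun j hj i => ?_⟩
  rw [length_rounds] at hj
  have h2 : (rounds F C k)[j]'(by rwa [length_rounds]) = F j (traj F C j) := by
    simp [rounds]
  rw [h2]
  refine (h j i ?_).eq_ite
  have := i.isLt
  calc j * n + i.val < j * n + n := by omega
    _ = (j + 1) * n := by ring
    _ ≤ k * n := Nat.mul_le_mul_right n hj

/-- A bound for the number of steps of the program, divided by `(n + 1) ^ 2`. -/
def algCost : ℕ :=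
  tableProg.bound + oppositeProg.bound + compareProg.bound + roundCost + copyProg.bound + 80

/-- The main loop stops after the `K` rounds of `cycleAlg_cases`, and a tie goes to the cycle, as in
`cycleAlg`. ERROR needs no separate treatment, since path sorting finishes within `n` rounds. -/
lemma runs_algProg (hn : 3 ≤ n) {C : Fin n → Fin n} (hC : Function.Bijective C) :
    Runs algProg (input C) (algCost * (n + 1) ^ 2) fun s => HoldsOutput s (cycleAlg C) := by
  have : NeZero n := ⟨by omega⟩
  obtain ⟨K, hKn, hmin, hK⟩ := cycleAlg_cases C (traj_pathRound_eq_id hn hC)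
  have hloop : ∀ s, Ready C 0 s → Runs (.loop (.and (.reg 7) (.reg 8)) roundProg) s
      (K * ((n + 1) * roundCost + 6) + 6) (Ready C K) := by
    intro s hs
    have hflag : ∀ i s, Ready C i s → IsBit ((Exp.and (.reg 7) (.reg 8)).eval s)
        (traj cycleRound C i ≠ id ∧ traj pathRound C i ≠ id) := fun i s hs =>
      IsBit.and (e := .reg 7) (f := .reg 8) hs.cycleFlag hs.pathFlag
    exact Runs.loop (e := .and (.reg 7) (.reg 8)) (Ready C)
      (fun i hi s hs => ⟨(hflag i s hs).ne_zero.2 (hmin i hi), runs_round hn (by omega) hs⟩)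
      (fun s hs => (hflag K s hs).2 fun h => hK.elim (fun h' => h.1 h'.1) fun h' => h.2 h'.2.1) hs
  have hout : ∀ s, Ready C K s →
      Runs (.cond (.eq (.reg 7) (.lit 0)) (forLoop 4 copyProg) .skip) s
        (4 + (K * n + 1) * (copyProg.bound + 10)) fun s => HoldsOutput s (cycleAlg C) := by
    intro s hs
    have hbit := isBit_eq s (.reg 7) (.lit 0)
    obtain ⟨h1, h2⟩ | ⟨h1, -, h2⟩ := hK
    · obtain ⟨t, s', h3, h4, h5⟩ := runs_copy hs.sim
      refine ⟨_, s', .cond_true (hbit.ne_zero.2 (hs.cycleFlag.2 (not_not.2 h1))) h3, ?_, ?_⟩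
      · simp only [Exp.cost]
        omega
      · rw [h2]
        exact holdsOutput_rounds h5.1 h5.2
    · refine ⟨_, s, .cond_false (hbit.2 ?_) (.skip s), ?_, ?_⟩
      · simp [Exp.eval, hs.cycleFlag.1 h1]
      · have := Nat.mul_le_mul (show 1 ≤ K * n + 1 by omega) (show 1 ≤ copyProg.bound + 10 by omega)
        simp only [Exp.cost]
        omega
      · rw [h2]
        exact holdsOutput_rounds hs.sim.count hs.sim.pathEdges
  refine (runs_tables.seq fun s hs => (runs_opposite hs).seq fun s hs => (runs_check hs).seq
    fun s hs => (hloop s hs).seq hout).mono ?_ fun s hs => hs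
  obtain ⟨m, hm⟩ : ∃ m, m = n + 1 := ⟨_, rfl⟩
  have h1 : m ≤ m ^ 2 := Nat.le_self_pow (by omega) m
  have h2 : K * m ≤ m ^ 2 := by rw [sq]; exact Nat.mul_le_mul_right m (by omega)
  have h3 : K * n + 1 ≤ m ^ 2 := by rw [hm]; nlinarith
  have h4 : K ≤ m ^ 2 := by omega
  rw [← hm]
  unfold algCost
  have e1 := Nat.mul_le_mul_right (tableProg.bound + 10) h1
  have e2 := Nat.mul_le_mul_right (oppositeProg.bound + 10) h1
  have e3 := Nat.mul_le_mul_right (compareProg.bound + 10) h1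
  have e4 := Nat.mul_le_mul_right roundCost h2
  have e5 := Nat.mul_le_mul_right (copyProg.bound + 10) h3
  have e6 : K * (m * roundCost + 6) = K * m * roundCost + 6 * K := by ring
  have e7 : 1 ≤ m ^ 2 := by omega
  rw [e6]
  generalize m ^ 2 = M at *
  linarith

theorem polyTimeOnCycles_cycleAlg : PolyTimeOnCycles fun _ C => cycleAlg C := by
  refine ⟨algProg, Polynomial.C algCost * (Polynomial.X + 1) ^ 2, fun n hn C => ?_⟩
  obtain ⟨t, s, h1, h2, h3⟩ := runs_algProg hn C.bijective
  exact ⟨t, s, h1, by simpa using h2, h3⟩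

end Program

end PTS

theorem theorem2 :
    PTS.PolyTimeOnCycles (fun _ C => PTS.cycleAlg C) ∧
    ∀ (n : ℕ), 3 ≤ n → ∀ C : Equiv.Perm (Fin n),
      PTS.IsSolution (SimpleGraph.cycleGraph n) C (PTS.cycleAlg C) ∧
      (Even n →
        (PTS.cycleAlg C).length ≤ 2 * PTS.opt (SimpleGraph.cycleGraph n) C) ∧
      (Odd n →
        (PTS.cycleAlg C).length ≤ 2 * PTS.opt (SimpleGraph.cycleGraph n) C + 1) := by
  refine ⟨PTS.polyTimeOnCycles_cycleAlg, fun n hn C => ?_⟩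
  have : NeZero n := ⟨by omega⟩
  have h := PTS.cycleAlg_approximation hn C.bijective
  refine ⟨PTS.isSolution_cycleAlg hn C.bijective, fun he => ?_, fun ho => ?_⟩
  · rwa [Nat.even_iff.1 he] at h
  · rwa [Nat.odd_iff.1 ho] at h
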